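/- Let $n\in\mathbb{N}$, $n\ge 1$, set $N=2^{\lfloor (n+1)/2\rfloor}$, and let $\alpha_1,\dots,\alpha_n,\alpha_{n+1}=\beta\in\mathbb{C}^{N\times N}$ be Hermitian matrices with $\alpha_j\alpha_k+\alpha_k\alpha_j=2\delta_{j,k}I_N$ for $1\le j,k\le n+1$. Let $$H_0=\alpha\cdot(-i\nabla)=\sum_{j=1}^n\alpha_j(-i\partial_j),\qquad \mathrm{dom}(H_0)=[W^{1,2}(\mathbb{R}^n)]^N,$$ be the free massless Dirac operator in $[L^2(\mathbb{R}^n)]^N=L^2(\mathbb{R}^n;\mathbb{C}^N)$. Let $V=\{V_{\ell,m}\}_{1\le\ell,m\le N}\in[L^\infty(\mathbb{R}^n)]^{N\times N}$ (not necessarily self-adjoint) satisfy, for some $C\in(0,\infty)$ and $\rho\in(n,\infty)$, $$|V_{\ell,m}(x)|\le C\langle x\rangle^{-\rho}\quad\text{for a.e. }x\in\mathbb{R}^n,\ 1\le\ell,m\le N,\qquad \langle x\rangle=(1+|x|^2)^{1/2},$$ and let $H=H_0+V$ with $\mathrm{dom}(H)=\mathrm{dom}(H_0)$. Let $k\in\mathbb{N}$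 with $k\ge n$ and let $z\in\mathbb{C}\setminus\mathbb{R}$. Then $z$ belongs to the resolvent set $\rho(H_0)$ of $H_0$; if $V(x)$ is Hermitian for a.e. $x$, then $z$ also belongs to the resolvent set $\rho(H)$ of $H$; and whenever $z\in\rho(H)$, the operator $$(H-z)^{-k}-(H_0-z)^{-k}$$ is trace class on $[L^2(\mathbb{R}^n)]^N$. -/

import Mathlib

open MeasureTheory
open scoped ENNReal SchwartzMap LineDeriv

/-- `[L²(ℝⁿ)]^N = L²(ℝⁿ; ℂ^N)`. -/
abbrev SpinorL2 (n N : ℕ) : Type :=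
  Lp (EuclideanSpace ℂ (Fin N)) 2 (volume : Measure (EuclideanSpace ℝ (Fin n)))

/-- `g` is the weak (distributional) partial derivative `∂_j f` of the `L²`-function `f`. -/
def HasWeakPartial {n N : ℕ} (j : Fin n) (f g : SpinorL2 n N) : Prop :=
  ∂_{EuclideanSpace.single j (1 : ℝ)}
    (f : 𝓢'(EuclideanSpace ℝ (Fin n), EuclideanSpace ℂ (Fin N))) =
    (g : 𝓢'(EuclideanSpace ℝ (Fin n), EuclideanSpace ℂ (Fin N)))

theorem spinor_toTempered_add {n N : ℕ} (f g : SpinorL2 n N) :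
    ((f + g : SpinorL2 n N) : 𝓢'(EuclideanSpace ℝ (Fin n), EuclideanSpace ℂ (Fin N))) =
      (f : 𝓢'(EuclideanSpace ℝ (Fin n), EuclideanSpace ℂ (Fin N))) + g :=
  map_add (Lp.toTemperedDistributionCLM (EuclideanSpace ℂ (Fin N))
    (volume : Measure (EuclideanSpace ℝ (Fin n))) 2) f g

theorem spinor_toTempered_smul {n N : ℕ} (c : ℂ) (f : SpinorL2 n N) :
    ((c • f : SpinorL2 n N) : 𝓢'(EuclideanSpace ℝ (Fin n), EuclideanSpace ℂ (Fin N))) =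
      c • (f : 𝓢'(EuclideanSpace ℝ (Fin n), EuclideanSpace ℂ (Fin N))) :=
  map_smul (Lp.toTemperedDistributionCLM (EuclideanSpace ℂ (Fin N))
    (volume : Measure (EuclideanSpace ℝ (Fin n))) 2) c f

theorem HasWeakPartial.unique {n N : ℕ} {j : Fin n} {f g g' : SpinorL2 n N}
    (h : HasWeakPartial j f g) (h' : HasWeakPartial j f g') : g = g' :=
  LinearMap.ker_eq_bot.mp (Lp.ker_toTemperedDistributionCLM_eq_bot
    (F := EuclideanSpace ℂ (Fin N)) (μ := (volume : Measure (EuclideanSpace ℝ (Fin n))))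
    (p := 2)) (h.symm.trans h')

theorem HasWeakPartial.add {n N : ℕ} {j : Fin n} {f₁ f₂ g₁ g₂ : SpinorL2 n N}
    (h₁ : HasWeakPartial j f₁ g₁) (h₂ : HasWeakPartial j f₂ g₂) :
    HasWeakPartial j (f₁ + f₂) (g₁ + g₂) := by
  unfold HasWeakPartial at *
  rw [spinor_toTempered_add, spinor_toTempered_add, LineDeriv.lineDerivOp_add, h₁, h₂]

theorem HasWeakPartial.smul {n N : ℕ} {j : Fin n} {f g : SpinorL2 n N} (c : ℂ)
    (h : HasWeakPartial j f g) : HasWeakPartial j (c • f) (c • g) := by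
  unfold HasWeakPartial at *
  rw [spinor_toTempered_smul, spinor_toTempered_smul, LineDeriv.lineDerivOp_smul, h]

/-- The Sobolev space `[W^{1,2}(ℝⁿ)]^N`: all first-order weak derivatives lie in `L²`. -/
def sobolevW12 (n N : ℕ) : Submodule ℂ (SpinorL2 n N) where
  carrier := {f | ∀ j : Fin n, ∃ g : SpinorL2 n N, HasWeakPartial j f g}
  add_mem' := fun h₁ h₂ j =>
    let ⟨g₁, hg₁⟩ := h₁ j
    let ⟨g₂, hg₂⟩ := h₂ j
    ⟨g₁ + g₂, hg₁.add hg₂⟩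
  zero_mem' := fun j => ⟨(0 : ℂ) • (0 : SpinorL2 n N), by
    have h : HasWeakPartial j ((0 : ℂ) • (0 : SpinorL2 n N)) ((0 : ℂ) • (0 : SpinorL2 n N)) := by
      unfold HasWeakPartial
      rw [spinor_toTempered_smul, LineDeriv.lineDerivOp_smul, zero_smul, zero_smul]
    simpa only [zero_smul] using h⟩
  smul_mem' := fun c _ h j =>
    let ⟨g, hg⟩ := h j
    ⟨c • g, hg.smul c⟩

/-- The weak partial derivative `∂_j : [W^{1,2}(ℝⁿ)]^N → [L²(ℝⁿ)]^N`. -/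
noncomputable def weakPartial {n N : ℕ} (j : Fin n) :
    sobolevW12 n N →ₗ[ℂ] SpinorL2 n N where
  toFun f := (f.2 j).choose
  map_add' f₁ f₂ := ((f₁ + f₂).2 j).choose_spec.unique
    ((f₁.2 j).choose_spec.add (f₂.2 j).choose_spec)
  map_smul' c f := ((c • f).2 j).choose_spec.unique ((f.2 j).choose_spec.smul c)

/-- The number of spinor components, `N = 2^⌊(n+1)/2⌋`. -/
abbrev spinorDim (n : ℕ) : ℕ := 2 ^ ((n + 1) / 2)

/-- `α 0, …, α n` (the last one being `β`) are anti-commuting Hermitian matrices with squares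
equal to the identity. -/
def IsDiracFamily {n N : ℕ} (α : Fin (n + 1) → Matrix (Fin N) (Fin N) ℂ) : Prop :=
  (∀ j, (α j).IsHermitian) ∧
    ∀ j k, α j * α k + α k * α j = if j = k then (2 : ℂ) • (1 : Matrix (Fin N) (Fin N) ℂ) else 0

/-- The free massless Dirac operator `H₀ = ∑_{j=1}^n α_j (-i ∂_j)` with domain
`[W^{1,2}(ℝⁿ)]^N`. -/
noncomputable def freeDirac {n N : ℕ} (α : Fin (n + 1) → Matrix (Fin N) (Fin N) ℂ) :
    SpinorL2 n N →ₗ.[ℂ] SpinorL2 n N where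
  domain := sobolevW12 n N
  toFun := ∑ j : Fin n,
    (((Matrix.toEuclideanCLM (𝕜 := ℂ) (α j.castSucc)).compLpL 2
      (volume : Measure (EuclideanSpace ℝ (Fin n))) : SpinorL2 n N →L[ℂ] SpinorL2 n N) :
        SpinorL2 n N →ₗ[ℂ] SpinorL2 n N) ∘ₗ ((-Complex.I) • weakPartial j)

theorem memLp_matrix_mulVec {n N : ℕ} {V : EuclideanSpace ℝ (Fin n) → Matrix (Fin N) (Fin N) ℂ}
    (hV : ∀ l m, MemLp (fun x => V x l m) ∞ volume) (f : SpinorL2 n N) :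
    MemLp (fun x => Matrix.toEuclideanCLM (𝕜 := ℂ) (V x) (f x)) 2 volume := by
  refine MemLp.of_eval_piLp fun l => ?_
  have h : ∀ m, MemLp (fun x => V x l m * f x m) 2 volume := fun m =>
    ((Lp.memLp f).eval_piLp m).mul (hV l m)
  have h' := memLp_finsetSum Finset.univ fun m _ => h m
  convert h' using 2 with x
  simp [Matrix.mulVec, dotProduct]

/-- The operator of multiplication by a matrix-valued `V ∈ [L^∞(ℝⁿ)]^{N×N}`,
`(V f)(x) = V(x) f(x)`. -/
noncomputable def mulOp {n N : ℕ} (V : EuclideanSpace ℝ (Fin n) → Matrix (Fin N) (Fin N) ℂ)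
    (hV : ∀ l m, MemLp (fun x => V x l m) ∞ volume) : SpinorL2 n N →ₗ[ℂ] SpinorL2 n N where
  toFun f := (memLp_matrix_mulVec hV f).toLp _
  map_add' f g := by
    rw [← MemLp.toLp_add]
    refine MemLp.toLp_congr _ _ ?_
    filter_upwards [Lp.coeFn_add f g] with x hx
    rw [hx, Pi.add_apply, Pi.add_apply, map_add]
  map_smul' c f := by
    rw [RingHom.id_apply, ← MemLp.toLp_const_smul]
    refine MemLp.toLp_congr _ _ ?_
    filter_upwards [Lp.coeFn_smul c f] with x hx
    rw [hx, Pi.smul_apply, Pi.smul_apply, map_smul]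

/-- The massless Dirac operator `H = H₀ + V` with domain `dom(H₀) = [W^{1,2}(ℝⁿ)]^N`. -/
noncomputable def dirac {n N : ℕ} (α : Fin (n + 1) → Matrix (Fin N) (Fin N) ℂ)
    (V : EuclideanSpace ℝ (Fin n) → Matrix (Fin N) (Fin N) ℂ)
    (hV : ∀ l m, MemLp (fun x => V x l m) ∞ volume) : SpinorL2 n N →ₗ.[ℂ] SpinorL2 n N :=
  mulOp V hV +ᵥ freeDirac α

/-- The bounded operator `R` is the resolvent `(T - z)⁻¹` of the (possibly unbounded) operator
`T`: it maps into `dom(T)` and is a two-sided inverse of `T - z : dom(T) → E`. -/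
def IsResolvent {E : Type*} [NormedAddCommGroup E] [NormedSpace ℂ E]
    (T : E →ₗ.[ℂ] E) (z : ℂ) (R : E →L[ℂ] E) : Prop :=
  (∀ f : E, ∃ h : R f ∈ T.domain, T ⟨R f, h⟩ - z • R f = f) ∧
    ∀ f : T.domain, R (T f - z • (f : E)) = f

/-- The resolvent set of a (possibly unbounded) operator. -/
def pmapResolventSet {E : Type*} [NormedAddCommGroup E] [NormedSpace ℂ E]
    (T : E →ₗ.[ℂ] E) : Set ℂ :=
  {z | ∃ R : E →L[ℂ] E, IsResolvent T z R}

/-- `T` is trace class: `∑ᵢ ⟨eᵢ, |T| eᵢ⟩ < ∞` for every orthonormal basis `(eᵢ)`, where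
`|T| = (T* T)^{1/2}`. -/
def IsTraceClass {E : Type*} [NormedAddCommGroup E] [InnerProductSpace ℂ E] [CompleteSpace E]
    (T : E →L[ℂ] E) : Prop :=
  ∀ (s : Set E) (b : HilbertBasis s ℂ E),
    Summable fun i => (inner ℂ (b i) (CFC.abs T (b i))).re

/-!
By the resolvent identity, `R ^ k - R₀ ^ k` is a sum of products `R ^ (j + 1) * V * R₀ ^ (k - j)`.
Call `γ` an order of `T` if `T` is approximated within `O(t ^ (-γ))` by operators of rank `O(t)`.
Orders add under composition, and an operator of order larger than `1` is trace class.

If `0 ≤ a ≤ 1`, then `⟨εx⟩⁻ᵃ (H₀ + D - z)⁻¹` with `D` bounded has every order `γ < a / n`: since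
`‖f(· + y) - f‖ ≤ |y| ‖H₀ f‖`, sampling on a mesh of small cubes approximates `(H₀ + D - z)⁻¹` on
bounded sets, and the decay of the weight allows for a coarser mesh on the more distant dyadic
shells. Next, `⟨εx⟩ˢ H₀ ⟨εx⟩⁻ˢ - H₀` is bounded with norm at most `sε`, so for small `ε` weights can
be moved through resolvents at the cost of a small bounded perturbation of `H₀` or `H`. Hence
`R ^ m ⟨εx⟩⁻ᵐᵃ` and `⟨εx⟩⁻ᵐᵃ R₀ ^ m` have order `mγ` for `m ≤ k`. As `ρ > n` and `k + 1 > n`, one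
can choose `a` with `n < (k + 1)a ≤ ρ`; the decay of `V` supplies the weights `⟨εx⟩^(-(j + 1)a)` and
`⟨εx⟩^(-(k - j)a)` on its two sides, and each summand has order `(k + 1)γ > 1` for suitable `γ`.
-/

section RankApproximation

theorem linearMap_rank_sub_le {K V W : Type*} [DivisionRing K] [AddCommGroup V] [Module K V]
    [AddCommGroup W] [Module K W] (f g : V →ₗ[K] W) : (f - g).rank ≤ f.rank + g.rank := by
  rw [sub_eq_add_neg]
  refine (LinearMap.rank_add_le f (-g)).trans ?_
  rw [LinearMap.rank, LinearMap.rank, LinearMap.rank, LinearMap.range_neg]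

variable {𝕜 E : Type*} [NontriviallyNormedField 𝕜] [NormedAddCommGroup E] [NormedSpace 𝕜 E]

/-- `T` is within operator-norm distance `ε` of an operator of rank at most `r`. The bound `r` is
real so that it can be estimated like `ε`. -/
def HasRankApprox (T : E →L[𝕜] E) (r ε : ℝ) : Prop :=
  ∃ (F : E →L[𝕜] E) (m : ℕ), (F : E →ₗ[𝕜] E).rank ≤ m ∧ (m : ℝ) ≤ r ∧ ‖T - F‖ ≤ ε

namespace HasRankApprox

variable {T S : E →L[𝕜] E} {r s ε δ : ℝ}

theorem mono (h : HasRankApprox T r ε) (hr : r ≤ s) (hε : ε ≤ δ) : HasRankApprox T s δ := by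
  obtain ⟨F, m, hF, hm, hTF⟩ := h
  exact ⟨F, m, hF, hm.trans hr, hTF.trans hε⟩

theorem of_norm_le (h : ‖T‖ ≤ ε) : HasRankApprox T 0 ε :=
  ⟨0, 0, by simp, by simp, by simpa using h⟩

theorem add (hT : HasRankApprox T r ε) (hS : HasRankApprox S s δ) :
    HasRankApprox (T + S) (r + s) (ε + δ) := by
  obtain ⟨F, m, hF, hm, hTF⟩ := hT
  obtain ⟨G, l, hG, hl, hSG⟩ := hS
  refine ⟨F + G, m + l, ?_, ?_, ?_⟩
  · exact (LinearMap.rank_add_le _ _).trans (by exact_mod_cast add_le_add hF hG)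
  · exact_mod_cast add_le_add hm hl
  · rw [add_sub_add_comm]
    exact norm_add_le_of_le hTF hSG

theorem mul (hT : HasRankApprox T r ε) (hS : HasRankApprox S s δ) :
    HasRankApprox (T * S) (r + s) (ε * δ) := by
  obtain ⟨F, m, hF, hm, hTF⟩ := hT
  obtain ⟨G, l, hG, hl, hSG⟩ := hS
  refine ⟨F * S + (T - F) * G, m + l, ?_, ?_, ?_⟩
  · have hFS : ((F * S : E →L[𝕜] E) : E →ₗ[𝕜] E).rank ≤ m :=
      (LinearMap.rank_comp_le_left _ _).trans hF
    have hG' : (((T - F) * G : E →L[𝕜] E) : E →ₗ[𝕜] E).rank ≤ l :=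
      (LinearMap.rank_comp_le_right _ _).trans hG
    exact (LinearMap.rank_add_le _ _).trans (by exact_mod_cast add_le_add hFS hG')
  · exact_mod_cast add_le_add hm hl
  · have hfactor : T * S - (F * S + (T - F) * G) = (T - F) * (S - G) := by noncomm_ring
    rw [hfactor]
    exact norm_mul_le_of_le hTF hSG

theorem sum {ι : Type*} (t : Finset ι) {T : ι → E →L[𝕜] E} {r ε : ι → ℝ}
    (h : ∀ i ∈ t, HasRankApprox (T i) (r i) (ε i)) :
    HasRankApprox (∑ i ∈ t, T i) (∑ i ∈ t, r i) (∑ i ∈ t, ε i) := by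
  classical
  induction t using Finset.induction_on with
  | empty => simpa using of_norm_le (T := (0 : E →L[𝕜] E)) norm_zero.le
  | insert i t hi ih =>
    simp only [Finset.sum_insert hi]
    exact (h i (Finset.mem_insert_self i t)).add
      (ih fun j hj => h j (Finset.mem_insert_of_mem hj))

end HasRankApprox

/-- The approximation numbers of `T` decay like `j ^ (-γ)`: rank `O(t)` suffices to approximate
`T` up to an error `O(t ^ (-γ))`. -/
def HasApproxOrder (T : E →L[𝕜] E) (γ : ℝ) : Prop :=
  ∃ C : ℝ, ∀ t : ℝ, 1 ≤ t → HasRankApprox T (C * t) (C * t ^ (-γ))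

namespace HasApproxOrder

variable {T S : E →L[𝕜] E} {γ δ : ℝ}

theorem zero_order (T : E →L[𝕜] E) : HasApproxOrder T 0 :=
  ⟨‖T‖, fun t _ => (HasRankApprox.of_norm_le le_rfl).mono (by positivity) (by simp)⟩

theorem zero (γ : ℝ) : HasApproxOrder (0 : E →L[𝕜] E) γ :=
  ⟨0, fun t _ => by simpa using HasRankApprox.of_norm_le (T := (0 : E →L[𝕜] E)) norm_zero.le⟩

theorem add (hT : HasApproxOrder T γ) (hS : HasApproxOrder S γ) : HasApproxOrder (T + S) γ := by
  obtain ⟨C, hC⟩ := hT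
  obtain ⟨D, hD⟩ := hS
  exact ⟨C + D, fun t ht => by simpa only [add_mul] using (hC t ht).add (hD t ht)⟩

theorem sum {ι : Type*} (s : Finset ι) {T : ι → E →L[𝕜] E}
    (h : ∀ i ∈ s, HasApproxOrder (T i) γ) : HasApproxOrder (∑ i ∈ s, T i) γ :=
  Finset.sum_induction _ (HasApproxOrder · γ) (fun _ _ => add) (zero γ) h

theorem mul (hT : HasApproxOrder T γ) (hS : HasApproxOrder S δ) :
    HasApproxOrder (T * S) (γ + δ) := by
  obtain ⟨C, hC⟩ := hT
  obtain ⟨D, hD⟩ := hS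
  refine ⟨max (C + D) (C * D), fun t ht => ((hC t ht).mul (hD t ht)).mono ?_ ?_⟩
  · rw [← add_mul]
    gcongr
    exact le_max_left _ _
  · rw [neg_add, Real.rpow_add (by linarith), mul_mul_mul_comm]
    gcongr
    exact le_max_right _ _

theorem exists_seq_rank_le (hT : HasApproxOrder T γ) :
    ∃ (C : ℝ) (F : ℕ → E →L[𝕜] E) (m : ℕ → ℕ), F 0 = 0 ∧ (∀ j, (F j : E →ₗ[𝕜] E).rank ≤ m j) ∧
      (∀ j, (m j : ℝ) ≤ C * 2 ^ j) ∧ ∀ j, ‖T - F j‖ ≤ C * (2 ^ (-γ)) ^ j := by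
  obtain ⟨C, hC⟩ := hT
  have approx (j : ℕ) : ∃ (F : E →L[𝕜] E) (m : ℕ), (j = 0 → F = 0) ∧
      (F : E →ₗ[𝕜] E).rank ≤ m ∧ (m : ℝ) ≤ max C ‖T‖ * 2 ^ j ∧
      ‖T - F‖ ≤ max C ‖T‖ * (2 ^ (-γ)) ^ j := by
    rcases eq_or_ne j 0 with rfl | hj
    · exact ⟨0, 0, by simp⟩
    · obtain ⟨F, m, hF, hm, hTF⟩ := hC (2 ^ j) (one_le_pow₀ one_le_two)
      have hpow : ((2 : ℝ) ^ j) ^ (-γ) = (2 ^ (-γ)) ^ j := by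
        rw [← Real.rpow_natCast_mul zero_le_two, ← Real.rpow_mul_natCast zero_le_two, mul_comm]
      refine ⟨F, m, fun h => absurd h hj, hF, hm.trans ?_, hTF.trans ?_⟩
      · gcongr
        exact le_max_left _ _
      · rw [hpow]
        gcongr
        exact le_max_left _ _
  choose F m hF0 hF hm hTF using approx
  exact ⟨_, F, m, hF0 0 rfl, hF, hm, hTF⟩

/-- The blocks of the series are the differences of the approximants along `t = 2 ^ j`. -/
theorem exists_hasSum_summable_rank_mul_norm (hT : HasApproxOrder T γ) (hγ : 1 < γ) :
    ∃ (D : ℕ → E →L[𝕜] E) (r : ℕ → ℕ), (∀ j, (D j : E →ₗ[𝕜] E).rank ≤ r j) ∧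
      (Summable fun j => r j * ‖D j‖) ∧ HasSum D T := by
  obtain ⟨C, F, m, hF0, hF, hm, hTF⟩ := hT.exists_seq_rank_le
  set q : ℝ := 2 ^ (-γ)
  have hq : 0 < q := by positivity
  have h2q : 2 * q < 1 := by
    have : q < 2 ^ (-1 : ℝ) := Real.rpow_lt_rpow_of_exponent_lt one_lt_two (by linarith)
    rw [Real.rpow_neg_one] at this
    linarith
  have hC : 0 ≤ C := by simpa using (norm_nonneg _).trans (hTF 0)
  have hrank (j : ℕ) : ((F (j + 1) - F j : E →L[𝕜] E) : E →ₗ[𝕜] E).rank ≤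
      (m (j + 1) + m j : ℕ) :=
    (linearMap_rank_sub_le _ _).trans (by exact_mod_cast add_le_add (hF (j + 1)) (hF j))
  have hcount (j : ℕ) : ((m (j + 1) + m j : ℕ) : ℝ) ≤ 3 * C * 2 ^ j := by
    have := hm (j + 1)
    rw [pow_succ] at this
    push_cast
    linarith [hm j]
  have hnorm (j : ℕ) : ‖F (j + 1) - F j‖ ≤ 2 * C * q ^ j := by
    have hmono : C * q ^ (j + 1) ≤ C * q ^ j :=
      mul_le_mul_of_nonneg_left (pow_le_pow_of_le_one hq.le (by linarith) j.le_succ) hC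
    have := norm_sub_le (T - F j) (T - F (j + 1))
    rw [sub_sub_sub_cancel_left] at this
    linarith [hTF j, hTF (j + 1)]
  have hsummable : Summable fun j => ‖F (j + 1) - F j‖ :=
    .of_nonneg_of_le (fun _ => norm_nonneg _) hnorm
      ((summable_geometric_of_lt_one hq.le (by linarith)).mul_left (2 * C))
  refine ⟨fun j => F (j + 1) - F j, fun j => m (j + 1) + m j, hrank, ?_, ?_⟩
  · refine .of_nonneg_of_le (fun _ => by positivity) (fun j => ?_)
      ((summable_geometric_of_lt_one (by positivity) h2q).mul_left (6 * C ^ 2))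
    calc _ ≤ 3 * C * 2 ^ j * (2 * C * q ^ j) :=
          mul_le_mul (hcount j) (hnorm j) (norm_nonneg _) (by positivity)
      _ = 6 * C ^ 2 * (2 * q) ^ j := by rw [mul_pow]; ring
  · rw [hasSum_iff_tendsto_nat_of_summable_norm hsummable]
    simp only [Finset.sum_range_sub, hF0, sub_zero]
    refine tendsto_iff_norm_sub_tendsto_zero.mpr (squeeze_zero (fun _ => norm_nonneg _)
      (fun j => (norm_sub_rev _ _).trans_le (hTF j)) ?_)
    simpa using (tendsto_pow_atTop_nhds_zero_of_lt_one hq.le (by linarith)).const_mul C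

theorem mul_right (hT : HasApproxOrder T γ) (B : E →L[𝕜] E) : HasApproxOrder (T * B) γ := by
  simpa using hT.mul (zero_order B)

end HasApproxOrder

end RankApproximation

section TraceClass

namespace HasRankApprox

variable {𝕜 E : Type*} [RCLike 𝕜] [NormedAddCommGroup E] [InnerProductSpace 𝕜 E]
  {r ε : ℝ}

theorem of_forall_exists_mem {T : E →L[𝕜] E} (U : Submodule 𝕜 E) [FiniteDimensional 𝕜 U]
    (hU : (Module.finrank 𝕜 U : ℝ) ≤ r) (hε : 0 ≤ ε)
    (h : ∀ f, ∃ g ∈ U, ‖T f - g‖ ≤ ε * ‖f‖) : HasRankApprox T r ε := by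
  refine ⟨U.starProjection * T, Module.finrank 𝕜 U, ?_, hU, ?_⟩
  · rw [Module.finrank_eq_rank]
    refine Submodule.rank_mono ?_
    rintro _ ⟨f, rfl⟩
    exact U.starProjection_apply_mem (T f)
  · refine ContinuousLinearMap.opNorm_le_bound _ hε fun f => ?_
    obtain ⟨g, hg, hfg⟩ := h f
    calc ‖T f - U.starProjection (T f)‖ = ⨅ u : U, ‖T f - u‖ := U.starProjection_minimal (T f)
      _ ≤ ‖T f - g‖ := ciInf_le ⟨0, by rintro _ ⟨u, rfl⟩; positivity⟩ (⟨g, hg⟩ : U)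
      _ ≤ ε * ‖f‖ := hfg

theorem of_norm_apply_le [CompleteSpace E] {A B : E →L[𝕜] E} (hB : HasRankApprox B r ε)
    (hAB : ∀ x, ‖A x‖ ≤ ‖B x‖) : HasRankApprox A r ε := by
  obtain ⟨F, m, hF, hm, hBF⟩ := hB
  have : CompleteSpace F.ker := F.isClosed_ker.completeSpace_coe
  have e : (F : E →ₗ[𝕜] E).range ≃ₗ[𝕜] F.kerᗮ := (F : E →ₗ[𝕜] E).quotKerEquivRange.symm.trans
    (F.ker.quotientEquivOfIsCompl F.kerᗮ (Submodule.isCompl_orthogonal _))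
  refine ⟨A * F.kerᗮ.starProjection, m, ?_, hm, ?_⟩
  · calc ((A * F.kerᗮ.starProjection : E →L[𝕜] E) : E →ₗ[𝕜] E).rank
        ≤ ((F.kerᗮ.starProjection : E →L[𝕜] E) : E →ₗ[𝕜] E).rank :=
          LinearMap.rank_comp_le_right _ _
      _ = Module.rank 𝕜 F.kerᗮ := congrArg (fun U : Submodule 𝕜 E => Module.rank 𝕜 U)
          (Submodule.range_starProjection F.kerᗮ)
      _ = (F : E →ₗ[𝕜] E).rank := e.rank_eq.symm
      _ ≤ m := hF
  · have hε : 0 ≤ ε := (norm_nonneg _).trans hBF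
    refine ContinuousLinearMap.opNorm_le_bound _ hε fun x => ?_
    set y := F.ker.starProjection x
    have hFy : F y = 0 := F.ker.starProjection_apply_mem x
    calc ‖A x - A (F.kerᗮ.starProjection x)‖ = ‖A y‖ := by
          rw [← map_sub, Submodule.starProjection_orthogonal_val, sub_sub_cancel]
      _ ≤ ‖B y‖ := hAB y
      _ = ‖(B - F) y‖ := by rw [sub_apply, hFy, sub_zero]
      _ ≤ ε * ‖x‖ := (B - F).le_of_opNorm_le_of_le hBF (F.ker.norm_starProjection_apply_le x)

end HasRankApprox

theorem HasApproxOrder.of_norm_apply_le {𝕜 E : Type*} [RCLike 𝕜] [NormedAddCommGroup E]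
    [InnerProductSpace 𝕜 E] [CompleteSpace E] {A B : E →L[𝕜] E} {γ : ℝ}
    (hB : HasApproxOrder B γ) (hAB : ∀ x, ‖A x‖ ≤ ‖B x‖) : HasApproxOrder A γ := by
  obtain ⟨C, hC⟩ := hB
  exact ⟨C, fun t ht => (hC t ht).of_norm_apply_le hAB⟩

section Diagonal

variable {𝕜 E ι : Type*} [RCLike 𝕜] [NormedAddCommGroup E] [InnerProductSpace 𝕜 E] {b : ι → E}

theorem sum_norm_inner_mul_norm_inner_le (hb : Orthonormal 𝕜 b) (s : Finset ι) (x y : E) :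
    ∑ i ∈ s, ‖inner 𝕜 (b i) x‖ * ‖inner 𝕜 (b i) y‖ ≤ ‖x‖ * ‖y‖ := by
  have bessel (v : E) : √(∑ i ∈ s, ‖inner 𝕜 (b i) v‖ ^ 2) ≤ ‖v‖ :=
    (Real.sqrt_le_left (norm_nonneg v)).mpr (hb.sum_inner_products_le v)
  exact (Real.sum_mul_le_sqrt_mul_sqrt _ _ _).trans (by gcongr <;> exact bessel _)

variable [CompleteSpace E]

theorem sum_norm_inner_apply_le_rank_mul_norm (hb : Orthonormal 𝕜 b) {D : E →L[𝕜] E} {r : ℕ}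
    (hD : (D : E →ₗ[𝕜] E).rank ≤ r) (s : Finset ι) :
    ∑ i ∈ s, ‖inner 𝕜 (b i) (D (b i))‖ ≤ r * ‖D‖ := by
  have : FiniteDimensional 𝕜 (D : E →ₗ[𝕜] E).range :=
    Module.rank_lt_aleph0_iff.mp (hD.trans_lt (Cardinal.natCast_lt_aleph0))
  have hr : Module.finrank 𝕜 (D : E →ₗ[𝕜] E).range ≤ r :=
    Module.finrank_le_of_rank_le hD
  set u := stdOrthonormalBasis 𝕜 (D : E →ₗ[𝕜] E).range
  have expand (i : ι) : ‖inner 𝕜 (b i) (D (b i))‖ ≤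
      ∑ j, ‖inner 𝕜 (b i) (u j : E)‖ * ‖inner 𝕜 (b i) (D.adjoint (u j))‖ := by
    have hsum : D (b i) = ∑ j, inner 𝕜 (u j : E) (D (b i)) • (u j : E) := by
      simpa using (congrArg Subtype.val (u.sum_repr' ⟨D (b i), ⟨b i, rfl⟩⟩)).symm
    rw [hsum, inner_sum]
    refine norm_sum_le_of_le _ fun j _ => ?_
    rw [inner_smul_right, norm_mul, mul_comm, ← ContinuousLinearMap.adjoint_inner_left,
      norm_inner_symm (D.adjoint _)]
  have hadj (j) : ‖(u j : E)‖ * ‖D.adjoint (u j)‖ ≤ ‖D‖ := by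
    have hu : ‖(u j : E)‖ = 1 := u.orthonormal.1 j
    have hDu := D.adjoint.le_opNorm (u j)
    rwa [hu, mul_one, ContinuousLinearMap.adjoint.norm_map, ← one_mul ‖D.adjoint _‖, ← hu] at hDu
  calc ∑ i ∈ s, ‖inner 𝕜 (b i) (D (b i))‖
      ≤ ∑ i ∈ s, ∑ j, ‖inner 𝕜 (b i) (u j : E)‖ * ‖inner 𝕜 (b i) (D.adjoint (u j))‖ :=
        Finset.sum_le_sum fun i _ => expand i
    _ = ∑ j, ∑ i ∈ s, ‖inner 𝕜 (b i) (u j : E)‖ * ‖inner 𝕜 (b i) (D.adjoint (u j))‖ :=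
        Finset.sum_comm
    _ ≤ ∑ _j : Fin (Module.finrank 𝕜 (D : E →ₗ[𝕜] E).range), ‖D‖ :=
        Finset.sum_le_sum fun j _ => (sum_norm_inner_mul_norm_inner_le hb s _ _).trans (hadj j)
    _ ≤ r * ‖D‖ := by
        rw [Finset.sum_const, Finset.card_univ, Fintype.card_fin, nsmul_eq_mul]
        gcongr

theorem summable_norm_inner_apply_of_hasSum (hb : Orthonormal 𝕜 b) {T : E →L[𝕜] E}
    {D : ℕ → E →L[𝕜] E} {r : ℕ → ℕ} (hD : ∀ j, (D j : E →ₗ[𝕜] E).rank ≤ r j)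
    (hsum : Summable fun j => r j * ‖D j‖) (hT : HasSum D T) :
    Summable fun i => ‖inner 𝕜 (b i) (T (b i))‖ := by
  refine summable_of_sum_le (c := ∑' j, r j * ‖D j‖) (fun _ => norm_nonneg _) fun s => ?_
  have htend : Filter.Tendsto
      (fun M => ∑ i ∈ s, ‖inner 𝕜 (b i) ((∑ j ∈ Finset.range M, D j) (b i))‖) Filter.atTop
      (nhds (∑ i ∈ s, ‖inner 𝕜 (b i) (T (b i))‖)) :=
    ((by fun_prop : Continuous fun A : E →L[𝕜] E =>
      ∑ i ∈ s, ‖inner 𝕜 (b i) (A (b i))‖).tendsto T).comp hT.tendsto_sum_nat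
  refine le_of_tendsto' htend fun M => ?_
  calc ∑ i ∈ s, ‖inner 𝕜 (b i) ((∑ j ∈ Finset.range M, D j) (b i))‖
      ≤ ∑ i ∈ s, ∑ j ∈ Finset.range M, ‖inner 𝕜 (b i) (D j (b i))‖ := by
        refine Finset.sum_le_sum fun i _ => ?_
        rw [sum_apply, inner_sum]
        exact norm_sum_le _ _
    _ = ∑ j ∈ Finset.range M, ∑ i ∈ s, ‖inner 𝕜 (b i) (D j (b i))‖ := Finset.sum_comm
    _ ≤ ∑ j ∈ Finset.range M, r j * ‖D j‖ :=
        Finset.sum_le_sum fun j _ => sum_norm_inner_apply_le_rank_mul_norm hb (hD j) s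
    _ ≤ ∑' j, r j * ‖D j‖ := hsum.sum_le_tsum _ fun _ _ => by positivity

end Diagonal

section AbsoluteValue

variable {E : Type*} [NormedAddCommGroup E] [InnerProductSpace ℂ E] [CompleteSpace E]

theorem norm_cfcAbs_apply (T : E →L[ℂ] E) (x : E) : ‖CFC.abs T x‖ = ‖T x‖ := by
  have hself : (CFC.abs T).adjoint = CFC.abs T := (CFC.abs_nonneg T).isSelfAdjoint.star_eq
  have hsq : (CFC.abs T).adjoint ∘L CFC.abs T = T.adjoint ∘L T := by
    rw [hself]
    exact CFC.abs_mul_abs T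
  rw [ContinuousLinearMap.apply_norm_eq_sqrt_inner_adjoint_left, hsq,
    ← ContinuousLinearMap.apply_norm_eq_sqrt_inner_adjoint_left]

theorem HasApproxOrder.isTraceClass {T : E →L[ℂ] E} {γ : ℝ} (hT : HasApproxOrder T γ)
    (hγ : 1 < γ) : IsTraceClass T := by
  intro s b
  have habs : HasApproxOrder (CFC.abs T) γ :=
    hT.of_norm_apply_le fun x => (norm_cfcAbs_apply T x).le
  obtain ⟨D, r, hD, hsum, hDT⟩ := habs.exists_hasSum_summable_rank_mul_norm hγ
  exact .of_norm_bounded (summable_norm_inner_apply_of_hasSum b.orthonormal hD hsum hDT)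
    fun i => Complex.abs_re_le_norm _

end AbsoluteValue

end TraceClass

section Resolvents

namespace IsResolvent

variable {E : Type*} [NormedAddCommGroup E] [NormedSpace ℂ E]
  {T : E →ₗ.[ℂ] E} {z : ℂ} {R D : E →L[ℂ] E}

theorem mem_domain (h : IsResolvent T z R) (f : E) : R f ∈ T.domain := (h.1 f).1

theorem apply_sub (h : IsResolvent T z R) (f : E) :
    T ⟨R f, h.mem_domain f⟩ - z • R f = f := (h.1 f).2

theorem eq_apply (h : IsResolvent T z R) {f g : E} (hf : f ∈ T.domain)
    (hfg : T ⟨f, hf⟩ - z • f = g) : R g = f := by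
  rw [← hfg]
  exact h.2 ⟨f, hf⟩

theorem mul_unit_inv (h : IsResolvent T z R) (u : (E →L[ℂ] E)ˣ) (hu : (u : E →L[ℂ] E) = 1 + D * R) :
    IsResolvent ((D : E →ₗ[ℂ] E) +ᵥ T) z (R * ↑u⁻¹) := by
  refine ⟨fun f => ⟨h.mem_domain _, ?_⟩, fun f => ?_⟩
  · have hinv : (1 + D * R) ((↑u⁻¹ : E →L[ℂ] E) f) = f := by
      rw [← hu, ← mul_apply_eq_comp, Units.mul_inv, one_apply_eq_self]
    rw [LinearPMap.vadd_apply, add_sub_assoc, add_comm]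
    exact (congrArg (· + D (R ((↑u⁻¹ : E →L[ℂ] E) f))) (h.apply_sub _)).trans hinv
  · have hinv : (↑u⁻¹ : E →L[ℂ] E) ((1 + D * R) (T f - z • (f : E))) = T f - z • (f : E) := by
      rw [← hu, ← mul_apply_eq_comp, Units.inv_mul, one_apply_eq_self]
    have hRf : R (T f - z • (f : E)) = f := h.2 f
    rw [add_apply, one_apply_eq_self, mul_apply_eq_comp, hRf] at hinv
    rw [LinearPMap.vadd_apply, add_sub_assoc, add_comm]
    exact (congrArg R hinv).trans hRf

theorem exists_vadd_of_norm_mul_lt_one [CompleteSpace E] (h : IsResolvent T z R)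
    (hD : ‖D‖ * ‖R‖ < 1) : ∃ R', IsResolvent ((D : E →ₗ[ℂ] E) +ᵥ T) z R' := by
  have hlt : ‖-(D * R)‖ < 1 := by
    rw [norm_neg]
    exact (norm_mul_le _ _).trans_lt hD
  exact ⟨_, h.mul_unit_inv (Units.oneSub (-(D * R)) hlt) (by simp)⟩

theorem mul_eq_mul {S : E →ₗ.[ℂ] E} {R' W : E →L[ℂ] E} (h : IsResolvent T z R)
    (h' : IsResolvent S z R')
    (hW : ∀ f (hf : f ∈ S.domain), ∃ hWf : W f ∈ T.domain, T ⟨W f, hWf⟩ = W (S ⟨f, hf⟩)) :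
    R * W = W * R' := by
  ext f
  obtain ⟨hmem, hTW⟩ := hW (R' f) (h'.mem_domain f)
  refine (h.eq_apply hmem ?_ : R (W f) = W (R' f))
  rw [hTW, ← map_smul, ← map_sub, h'.apply_sub]

theorem vadd_sub_eq {R' : E →L[ℂ] E} (h' : IsResolvent ((D : E →ₗ[ℂ] E) +ᵥ T) z R')
    (h : IsResolvent T z R) : R' - R = R' * (-D) * R := by
  ext f
  have hsum : R' (D (R f)) + R' f = R f := by
    rw [← map_add]
    refine h'.eq_apply (h.mem_domain f) ?_
    rw [LinearPMap.vadd_apply, add_sub_assoc, h.apply_sub]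
    rfl
  calc R' f - R f = R' f - (R' (D (R f)) + R' f) := by rw [hsum]
    _ = -R' (D (R f)) := by abel
    _ = (R' * (-D) * R) f := (map_neg R' _).symm

end IsResolvent

theorem pow_sub_pow_eq_sum_mul_sub_mul {A : Type*} [Ring A] (a b : A) (k : ℕ) :
    a ^ k - b ^ k = ∑ j ∈ Finset.range k, a ^ j * (a - b) * b ^ (k - 1 - j) := by
  have htele := Finset.sum_range_sub (fun j => a ^ j * b ^ (k - j)) k
  rw [Nat.sub_self, pow_zero, pow_zero, mul_one, one_mul, Nat.sub_zero] at htele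
  rw [← htele]
  refine Finset.sum_congr rfl fun j hj => ?_
  have hk : k - j = k - 1 - j + 1 := by have := Finset.mem_range.mp hj; omega
  rw [hk, pow_succ' b, pow_succ a, show k - (j + 1) = k - 1 - j by omega]
  noncomm_ring

theorem IsResolvent.pow_sub_pow {E : Type*} [NormedAddCommGroup E] [NormedSpace ℂ E]
    {T : E →ₗ.[ℂ] E} {z : ℂ} {R R' D : E →L[ℂ] E}
    (h' : IsResolvent ((D : E →ₗ[ℂ] E) +ᵥ T) z R') (h : IsResolvent T z R) (k : ℕ) :
    R' ^ k - R ^ k = ∑ j ∈ Finset.range k, R' ^ (j + 1) * (-D) * R ^ (k - j) := by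
  rw [pow_sub_pow_eq_sum_mul_sub_mul]
  refine Finset.sum_congr rfl fun j hj => ?_
  have hk : k - j = k - 1 - j + 1 := by have := Finset.mem_range.mp hj; omega
  rw [h'.vadd_sub_eq h, hk, pow_succ R', pow_succ' R]
  noncomm_ring

end Resolvents

section SymmetricOperators

variable {E : Type*} [NormedAddCommGroup E] [InnerProductSpace ℂ E]
  {T : E →ₗ.[ℂ] E} {z : ℂ} {R D : E →L[ℂ] E}

theorem abs_im_mul_norm_le_norm_sub_smul {f g : E} (hfg : (inner ℂ f g).im = 0) (z : ℂ) :
    |z.im| * ‖f‖ ≤ ‖g - z • f‖ := by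
  have him : (inner ℂ f (g - z • f)).im = -z.im * ‖f‖ ^ 2 := by
    rw [inner_sub_right, inner_smul_right, inner_self_eq_norm_sq_to_K, Complex.sub_im, hfg]
    simp [← Complex.ofReal_pow]
  rcases (norm_nonneg f).eq_or_lt with hf | hf
  · simp [← hf]
  · refine le_of_mul_le_mul_left ?_ hf
    calc ‖f‖ * (|z.im| * ‖f‖) = |(inner ℂ f (g - z • f)).im| := by
          rw [him, abs_mul, abs_neg, abs_of_nonneg (sq_nonneg ‖f‖)]
          ring
      _ ≤ ‖inner ℂ f (g - z • f)‖ := Complex.abs_im_le_norm _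
      _ ≤ ‖f‖ * ‖g - z • f‖ := norm_inner_le_norm _ _

theorem abs_im_mul_norm_le_of_isFormalAdjoint_self (hT : T.IsFormalAdjoint T) (z : ℂ)
    (f : T.domain) : |z.im| * ‖(f : E)‖ ≤ ‖T f - z • (f : E)‖ :=
  abs_im_mul_norm_le_norm_sub_smul
    (Complex.conj_eq_iff_im.mp ((inner_conj_symm _ _).trans (hT f f))) z

namespace IsResolvent

theorem of_right_inverse_of_isFormalAdjoint_self (hz : z.im ≠ 0) (hT : T.IsFormalAdjoint T)
    (hR : ∀ f : E, ∃ h : R f ∈ T.domain, T ⟨R f, h⟩ - z • R f = f) : IsResolvent T z R := by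
  refine ⟨hR, fun f => ?_⟩
  obtain ⟨hmem, hRf⟩ := hR (T f - z • (f : E))
  set g : T.domain := ⟨R (T f - z • (f : E)), hmem⟩
  have hker : T (g - f) - z • ((g - f : T.domain) : E) = 0 := by
    have hg : T g - z • (g : E) = T f - z • (f : E) := hRf
    rw [LinearPMap.map_sub, Submodule.coe_sub, smul_sub, sub_sub_sub_comm, hg, sub_self]
  have hbound := abs_im_mul_norm_le_of_isFormalAdjoint_self hT z (g - f)
  rw [hker, norm_zero] at hbound
  have hzero : ‖((g - f : T.domain) : E)‖ = 0 :=
    le_antisymm (nonpos_of_mul_nonpos_right hbound (abs_pos.mpr hz)) (norm_nonneg _)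
  rwa [norm_eq_zero, Submodule.coe_sub, sub_eq_zero] at hzero

theorem norm_le_of_isFormalAdjoint_self (h : IsResolvent T z R) (hz : z.im ≠ 0)
    (hT : T.IsFormalAdjoint T) : ‖R‖ ≤ |z.im|⁻¹ := by
  refine ContinuousLinearMap.opNorm_le_bound _ (by positivity) fun f => ?_
  have hbound := abs_im_mul_norm_le_of_isFormalAdjoint_self hT z ⟨R f, h.mem_domain f⟩
  rw [h.apply_sub] at hbound
  rwa [inv_mul_eq_div, le_div_iff₀ (abs_pos.mpr hz), mul_comm]

theorem exists_vadd_of_isFormalAdjoint_self [CompleteSpace E] (h : IsResolvent T z R)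
    (hz : z.im ≠ 0) (hT : T.IsFormalAdjoint T) (hD : ‖D‖ < |z.im|) :
    ∃ R', IsResolvent ((D : E →ₗ[ℂ] E) +ᵥ T) z R' :=
  h.exists_vadd_of_norm_mul_lt_one <|
    calc ‖D‖ * ‖R‖ ≤ ‖D‖ * |z.im|⁻¹ := by
          gcongr
          exact h.norm_le_of_isFormalAdjoint_self hz hT
      _ < 1 := by rwa [← div_eq_mul_inv, div_lt_one (abs_pos.mpr hz)]

theorem exists_nsmul_vadd_of_isSymmetric [CompleteSpace E] (h : IsResolvent T z R)
    (hz : z.im ≠ 0) (hT : T.IsFormalAdjoint T) (hD : (D : E →ₗ[ℂ] E).IsSymmetric)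
    (hnorm : ‖D‖ < |z.im|) (j : ℕ) :
    ∃ R', IsResolvent (((j • D : E →L[ℂ] E) : E →ₗ[ℂ] E) +ᵥ T) z R' := by
  induction j with
  | zero => exact ⟨R, by simpa using h⟩
  | succ j ih =>
    obtain ⟨R₁, hR₁⟩ := ih
    have hsymm : (((j • D : E →L[ℂ] E) : E →ₗ[ℂ] E) +ᵥ T).IsFormalAdjoint
        (((j • D : E →L[ℂ] E) : E →ₗ[ℂ] E) +ᵥ T) := fun f g => by
      have hjD : inner ℂ ((j • D) (f : E)) (g : E) = inner ℂ (f : E) ((j • D) (g : E)) := by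
        simpa [Nat.cast_smul_eq_nsmul] using hD.smul (c := (j : ℂ)) (by simp) (f : E) (g : E)
      rw [LinearPMap.vadd_apply, LinearPMap.vadd_apply, inner_add_left, inner_add_right]
      exact congrArg₂ (· + ·) hjD (hT f g)
    obtain ⟨R₂, hR₂⟩ := hR₁.exists_vadd_of_isFormalAdjoint_self hz hsymm hnorm
    refine ⟨R₂, ?_⟩
    rwa [← add_vadd, ← ContinuousLinearMap.toLinearMap_add, ← succ_nsmul'] at hR₂

/-- Add `D` in small steps: the resolvent bound `|Im z|⁻¹` is the same at each of them. -/
theorem exists_vadd_of_isSymmetric [CompleteSpace E] (h : IsResolvent T z R) (hz : z.im ≠ 0)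
    (hT : T.IsFormalAdjoint T) (hD : (D : E →ₗ[ℂ] E).IsSymmetric) :
    ∃ R', IsResolvent ((D : E →ₗ[ℂ] E) +ᵥ T) z R' := by
  obtain ⟨m, hm⟩ := exists_nat_gt (‖D‖ / |z.im|)
  have hm0 : (0 : ℝ) < m := lt_of_le_of_lt (by positivity) hm
  have hsymm : (((m : ℂ)⁻¹ • D : E →L[ℂ] E) : E →ₗ[ℂ] E).IsSymmetric := hD.smul (by simp)
  have hnorm : ‖(m : ℂ)⁻¹ • D‖ < |z.im| := by
    rw [norm_smul, norm_inv, Complex.norm_natCast, inv_mul_lt_iff₀ hm0]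
    exact (div_lt_iff₀ (abs_pos.mpr hz)).mp hm
  have hmD : m • (m : ℂ)⁻¹ • D = D := by
    rw [← Nat.cast_smul_eq_nsmul ℂ, smul_inv_smul₀ (by exact_mod_cast hm0.ne')]
  simpa only [hmD] using h.exists_nsmul_vadd_of_isSymmetric hz hT hsymm hnorm m

end IsResolvent

end SymmetricOperators

section Multiplication

section Scalar

variable {X 𝕜 F : Type*} [MeasurableSpace X] {μ : Measure X} [NontriviallyNormedField 𝕜]
  [NormedAddCommGroup F] [NormedSpace 𝕜 F] {p : ℝ≥0∞} [Fact (1 ≤ p)] {φ ψ : X → 𝕜}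

/-- Multiplication by a bounded scalar function, as a bounded operator on `Lᵖ`. -/
noncomputable def smulCLM (hφ : MemLp φ ∞ μ) : Lp F p μ →L[𝕜] Lp F p μ :=
  (ContinuousLinearMap.lsmul 𝕜 𝕜).holderL μ ∞ p p (hφ.toLp φ)

theorem coeFn_smulCLM (hφ : MemLp φ ∞ μ) (f : Lp F p μ) :
    smulCLM hφ f =ᵐ[μ] fun x => φ x • f x := by
  filter_upwards [(ContinuousLinearMap.lsmul 𝕜 𝕜 (E := F)).coeFn_holder (r := p) (hφ.toLp φ) f,
    hφ.coeFn_toLp] with x hx hφx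
  rw [← hφx]
  exact hx

theorem norm_smulCLM_le (hφ : MemLp φ ∞ μ) {c : ℝ} (hc : 0 ≤ c) (h : ∀ᵐ x ∂μ, ‖φ x‖ ≤ c) :
    ‖(smulCLM hφ : Lp F p μ →L[𝕜] Lp F p μ)‖ ≤ c := by
  refine ContinuousLinearMap.opNorm_le_bound _ hc fun f => Lp.norm_le_mul_norm_of_ae_le_mul ?_
  filter_upwards [h, coeFn_smulCLM hφ f] with x hx hfx
  rw [hfx, norm_smul]
  gcongr

theorem smulCLM_mul_smulCLM (hφ : MemLp φ ∞ μ) (hψ : MemLp ψ ∞ μ)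
    (hφψ : MemLp (fun x => φ x * ψ x) ∞ μ) :
    (smulCLM hφ : Lp F p μ →L[𝕜] Lp F p μ) * smulCLM hψ = smulCLM hφψ := by
  ext1 f
  refine Lp.ext ?_
  filter_upwards [coeFn_smulCLM hφ (smulCLM hψ f), coeFn_smulCLM hψ f, coeFn_smulCLM hφψ f]
    with x hφx hψx hφψx
  rw [mul_apply_eq_comp, hφx, hψx, hφψx, smul_smul]

theorem smulCLM_sub_smulCLM (hφ : MemLp φ ∞ μ) (hψ : MemLp ψ ∞ μ)
    (hφψ : MemLp (fun x => φ x - ψ x) ∞ μ) :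
    (smulCLM hφ : Lp F p μ →L[𝕜] Lp F p μ) - smulCLM hψ = smulCLM hφψ := by
  ext1 f
  refine Lp.ext ?_
  filter_upwards [Lp.coeFn_sub (smulCLM hφ f) (smulCLM hψ f), coeFn_smulCLM hφ f,
    coeFn_smulCLM hψ f, coeFn_smulCLM hφψ f] with x hsub hφx hψx hφψx
  rw [sub_apply, hsub, Pi.sub_apply, hφx, hψx, hφψx, sub_smul]

theorem compLpL_smulCLM (hφ : MemLp φ ∞ μ) (A : F →L[𝕜] F) (f : Lp F p μ) :
    A.compLpL p μ (smulCLM hφ f) = smulCLM hφ (A.compLpL p μ f) := by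
  refine Lp.ext ?_
  filter_upwards [A.coeFn_compLpL (smulCLM hφ f), A.coeFn_compLpL f, coeFn_smulCLM hφ f,
    coeFn_smulCLM hφ (A.compLpL p μ f)] with x hA hAf hφf hφA
  rw [hA, hφf, hφA, hAf, map_smul]

end Scalar

section Matrix

variable {n N : ℕ} {V : EuclideanSpace ℝ (Fin n) → Matrix (Fin N) (Fin N) ℂ}

theorem norm_entry_le_norm_toEuclideanCLM (A : Matrix (Fin N) (Fin N) ℂ) (l m : Fin N) :
    ‖A l m‖ ≤ ‖Matrix.toEuclideanCLM (𝕜 := ℂ) A‖ := by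
  have hentry : ‖A l m‖ ≤ ‖Matrix.toEuclideanCLM (𝕜 := ℂ) A (EuclideanSpace.single m 1)‖ := by
    simpa [Matrix.ofLp_toEuclideanCLM] using
      PiLp.norm_apply_le (Matrix.toEuclideanCLM (𝕜 := ℂ) A (EuclideanSpace.single m 1)) l
  exact hentry.trans ((Matrix.toEuclideanCLM (𝕜 := ℂ) A).unit_le_opNorm _ (by simp))

theorem coeFn_mulOp (hV : ∀ l m, MemLp (fun x => V x l m) ∞ volume) (f : SpinorL2 n N) :
    mulOp V hV f =ᵐ[volume] fun x => Matrix.toEuclideanCLM (𝕜 := ℂ) (V x) (f x) :=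
  (memLp_matrix_mulVec hV f).coeFn_toLp

theorem mulOp_eq_sum_compLpL_smulCLM (hV : ∀ l m, MemLp (fun x => V x l m) ∞ volume)
    (f : SpinorL2 n N) :
    mulOp V hV f = ∑ l, ∑ m, (Matrix.toEuclideanCLM (𝕜 := ℂ) (Matrix.single l m 1)).compLpL 2 volume
      (smulCLM (hV l m) f) := by
  refine Lp.ext ?_
  have hterm : ∀ᵐ x, ∀ l m, (Matrix.toEuclideanCLM (𝕜 := ℂ) (Matrix.single l m 1)).compLpL 2 volume
      (smulCLM (hV l m) f) x =
        Matrix.toEuclideanCLM (𝕜 := ℂ) (Matrix.single l m (V x l m)) (f x) := by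
    refine ae_all_iff.mpr fun l => ae_all_iff.mpr fun m => ?_
    filter_upwards [ContinuousLinearMap.coeFn_compLpL (Matrix.toEuclideanCLM (𝕜 := ℂ)
      (Matrix.single l m 1)) (smulCLM (hV l m) f), coeFn_smulCLM (hV l m) f] with x hcomp hsmul
    rw [hcomp, hsmul, map_smul, ← smul_apply, ← map_smul, Matrix.smul_single, smul_eq_mul, mul_one]
  have hsum : ∀ᵐ x, ∀ l, (∑ m, (Matrix.toEuclideanCLM (𝕜 := ℂ) (Matrix.single l m 1)).compLpL 2
      volume (smulCLM (hV l m) f)) x = ∑ m, (Matrix.toEuclideanCLM (𝕜 := ℂ)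
        (Matrix.single l m 1)).compLpL 2 volume (smulCLM (hV l m) f) x :=
    ae_all_iff.mpr fun l => Lp.coeFn_fun_finsetSum _ _
  filter_upwards [coeFn_mulOp hV f, hterm, hsum, Lp.coeFn_fun_finsetSum Finset.univ fun l => ∑ m,
    (Matrix.toEuclideanCLM (𝕜 := ℂ) (Matrix.single l m 1)).compLpL 2 volume
      (smulCLM (hV l m) f)] with x hVx hx hinner houter
  rw [hVx, houter]
  conv_lhs => rw [Matrix.matrix_eq_sum_single (V x)]
  simp only [hinner, hx, sum_apply, map_sum]

/-- Multiplication by a bounded matrix-valued function, `mulOp`, as a bounded operator. -/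
noncomputable def mulCLM (V : EuclideanSpace ℝ (Fin n) → Matrix (Fin N) (Fin N) ℂ)
    (hV : ∀ l m, MemLp (fun x => V x l m) ∞ volume) : SpinorL2 n N →L[ℂ] SpinorL2 n N where
  toLinearMap := mulOp V hV
  cont := by
    simp only [LinearMap.toFun_eq_coe]
    rw [funext (mulOp_eq_sum_compLpL_smulCLM hV)]
    fun_prop

theorem coeFn_mulCLM (hV : ∀ l m, MemLp (fun x => V x l m) ∞ volume) (f : SpinorL2 n N) :
    mulCLM V hV f =ᵐ[volume] fun x => Matrix.toEuclideanCLM (𝕜 := ℂ) (V x) (f x) :=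
  coeFn_mulOp hV f

theorem norm_mulCLM_le (hV : ∀ l m, MemLp (fun x => V x l m) ∞ volume) {c : ℝ} (hc : 0 ≤ c)
    (h : ∀ᵐ x, ‖Matrix.toEuclideanCLM (𝕜 := ℂ) (V x)‖ ≤ c) : ‖mulCLM V hV‖ ≤ c := by
  refine ContinuousLinearMap.opNorm_le_bound _ hc fun f => Lp.norm_le_mul_norm_of_ae_le_mul ?_
  filter_upwards [h, coeFn_mulCLM hV f] with x hx hfx
  rw [hfx]
  exact ContinuousLinearMap.le_of_opNorm_le _ hx _

theorem smulCLM_mul_mulCLM {φ : EuclideanSpace ℝ (Fin n) → ℂ} (hφ : MemLp φ ∞ volume)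
    {U : EuclideanSpace ℝ (Fin n) → Matrix (Fin N) (Fin N) ℂ}
    (hU : ∀ l m, MemLp (fun x => U x l m) ∞ volume)
    (hV : ∀ l m, MemLp (fun x => V x l m) ∞ volume) (h : ∀ᵐ x, φ x • U x = V x) :
    smulCLM hφ * mulCLM U hU = mulCLM V hV := by
  ext1 f
  refine Lp.ext ?_
  filter_upwards [h, coeFn_smulCLM hφ (mulCLM U hU f), coeFn_mulCLM hU f, coeFn_mulCLM hV f]
    with x hx hφx hUx hVx
  rw [mul_apply_eq_comp, hφx, hUx, hVx, ← hx, map_smul, smul_apply]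

theorem smulCLM_commute_mulCLM {φ : EuclideanSpace ℝ (Fin n) → ℂ} (hφ : MemLp φ ∞ volume)
    (hV : ∀ l m, MemLp (fun x => V x l m) ∞ volume) : Commute (smulCLM hφ) (mulCLM V hV) := by
  ext1 f
  refine Lp.ext ?_
  filter_upwards [coeFn_smulCLM hφ (mulCLM V hV f), coeFn_mulCLM hV f, coeFn_smulCLM hφ f,
    coeFn_mulCLM hV (smulCLM hφ f)] with x hφV hVx hφx hVφ
  rw [mul_apply_eq_comp, mul_apply_eq_comp, hφV, hVx, hVφ, hφx, map_smul]

theorem isSymmetric_mulOp (hV : ∀ l m, MemLp (fun x => V x l m) ∞ volume)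
    (h : ∀ᵐ x, (V x).IsHermitian) : (mulOp V hV).IsSymmetric := fun f g => by
  rw [L2.inner_def, L2.inner_def]
  refine integral_congr_ae ?_
  filter_upwards [h, coeFn_mulOp hV f, coeFn_mulOp hV g] with x hx hf hg
  rw [hf, hg]
  exact Matrix.isSymmetric_toEuclideanLin_iff.mpr hx _ _

end Matrix

end Multiplication

section FourierSide

open FourierTransform

variable {E F F' : Type*} [NormedAddCommGroup E] [InnerProductSpace ℝ E]
  [MeasurableSpace E] [BorelSpace E] [NormedAddCommGroup F] [NormedAddCommGroup F']

section Translation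

variable [FiniteDimensional ℝ E] [NormedSpace ℂ F] {p : ℝ≥0∞} [Fact (1 ≤ p)]

/-- The translate `x ↦ f (x + y)` of an `Lᵖ` function. -/
noncomputable def translateLp (y : E) :
    Lp F p (volume : Measure E) →ₗᵢ[ℂ] Lp F p (volume : Measure E) :=
  Lp.compMeasurePreservingₗᵢ ℂ (· + y) (measurePreserving_add_right volume y)

theorem coeFn_translateLp (y : E) (f : Lp F p (volume : Measure E)) :
    translateLp y f =ᵐ[volume] fun x => f (x + y) :=
  Lp.coeFn_compMeasurePreserving f (measurePreserving_add_right volume y)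

theorem translateLp_toLp (y : E) (g : 𝓢(E, F)) :
    translateLp y (g.toLp p : Lp F p (volume : Measure E)) =
      (SchwartzMap.compSubConstCLM ℂ (-y) g).toLp p := by
  refine Lp.ext ?_
  filter_upwards [coeFn_translateLp y (g.toLp p : Lp F p (volume : Measure E)),
    (SchwartzMap.compSubConstCLM ℂ (-y) g).coeFn_toLp p volume,
    (measurePreserving_add_right volume y).quasiMeasurePreserving.ae
      (g.coeFn_toLp p volume)] with x htranslate hcomp hg
  rw [htranslate, hcomp, hg, SchwartzMap.compSubConstCLM_apply, sub_neg_eq_add]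

end Translation

section Distributions

variable [NormedSpace ℂ F] [CompleteSpace F] [NormedSpace ℂ F'] [CompleteSpace F'] {p : ℝ≥0∞}
  [Fact (1 ≤ p)] {μ : Measure E} [μ.HasTemperateGrowth] {φ : E → ℂ} {u v : Lp F p μ}

theorem toTemperedDistribution_injective [FiniteDimensional ℝ E] [IsLocallyFiniteMeasure μ] :
    Function.Injective fun f : Lp F p μ => (f : 𝓢'(E, F)) :=
  LinearMap.ker_eq_bot.mp Lp.ker_toTemperedDistributionCLM_eq_bot

theorem smulLeftCLM_toTemperedDistribution_of_ae_eq (hφ : φ.HasTemperateGrowth)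
    (h : v =ᵐ[μ] fun x => φ x • u x) :
    TemperedDistribution.smulLeftCLM F φ (u : 𝓢'(E, F)) = v := by
  ext ψ : 1
  simp only [TemperedDistribution.smulLeftCLM_apply_apply, Lp.toTemperedDistribution_apply,
    SchwartzMap.smulLeftCLM_apply_apply hφ]
  refine integral_congr_ae ?_
  filter_upwards [h] with x hx
  rw [hx, smul_smul, smul_eq_mul, mul_comm]

theorem integral_smul_smul_eq_of_smulLeftCLM_toTemperedDistribution_eq
    (hφ : φ.HasTemperateGrowth)
    (h : TemperedDistribution.smulLeftCLM F φ (u : 𝓢'(E, F)) = v) {g : E → ℝ}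
    (hg : ContDiff ℝ (⊤ : ℕ∞) g) (hgc : HasCompactSupport g) :
    ∫ x, g x • (φ x • u x) ∂μ = ∫ x, g x • v x ∂μ := by
  have hgc' : HasCompactSupport (Complex.ofRealCLM ∘ g) := hgc.comp_left rfl
  have hg' : ContDiff ℝ (⊤ : ℕ∞) (Complex.ofRealCLM ∘ g) := by fun_prop
  have happly := congrArg (fun T => T (hgc'.toSchwartzMap hg')) h
  simpa [TemperedDistribution.smulLeftCLM_apply_apply, Lp.toTemperedDistribution_apply,
    SchwartzMap.smulLeftCLM_apply_apply hφ, mul_comm (φ _), mul_smul] using happly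

theorem smulLeftCLM_toTemperedDistribution_eq_iff [FiniteDimensional ℝ E] [IsLocallyFiniteMeasure μ]
    (hφ : φ.HasTemperateGrowth) :
    TemperedDistribution.smulLeftCLM F φ (u : 𝓢'(E, F)) = v ↔ v =ᵐ[μ] fun x => φ x • u x := by
  refine ⟨fun h => ?_, smulLeftCLM_toTemperedDistribution_of_ae_eq hφ⟩
  have hv : LocallyIntegrable v μ := (Lp.memLp v).locallyIntegrable Fact.out
  have hφu : LocallyIntegrable (fun x => φ x • u x) μ :=
    ((Lp.memLp u).locallyIntegrable Fact.out).continuous_smul hφ.1.continuous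
  have hzero : ∀ᵐ x ∂μ, v x - φ x • u x = 0 := by
    refine ae_eq_zero_of_integral_contDiff_smul_eq_zero (hv.sub hφu) fun g hg hgc => ?_
    simp only [smul_sub]
    rw [integral_sub (hv.integrable_smul_left_of_hasCompactSupport hg.continuous hgc)
      (hφu.integrable_smul_left_of_hasCompactSupport hg.continuous hgc),
      integral_smul_smul_eq_of_smulLeftCLM_toTemperedDistribution_eq hφ h hg hgc, sub_self]
  filter_upwards [hzero] with x hx
  exact sub_eq_zero.mp hx

theorem compLpL_toTemperedDistribution_apply (A : F →L[ℂ] F') (u : Lp F p μ) (ψ : 𝓢(E, ℂ)) :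
    ((A.compLpL p μ u : Lp F' p μ) : 𝓢'(E, F')) ψ = A ((u : 𝓢'(E, F)) ψ) := by
  have := ENNReal.HolderConjugate.inv_one_sub_inv' (Fact.out : 1 ≤ p)
  have hint : Integrable (fun x => ψ x • u x) μ :=
    memLp_one_iff_integrable.mp ((Lp.memLp u).smul (ψ.memLp (1 - p⁻¹)⁻¹ μ))
  rw [Lp.toTemperedDistribution_apply, Lp.toTemperedDistribution_apply,
    ← A.integral_comp_comm hint]
  refine integral_congr_ae ?_
  filter_upwards [A.coeFn_compLpL u] with x hx
  rw [hx, map_smul]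

end Distributions

variable [FiniteDimensional ℝ E] [InnerProductSpace ℂ F] [CompleteSpace F]
  [InnerProductSpace ℂ F'] [CompleteSpace F']

theorem lineDerivOp_toTemperedDistribution_eq_iff_fourier {m : E}
    {f g : Lp F 2 (volume : Measure E)} :
    ∂_{m} (f : 𝓢'(E, F)) = g ↔
      (𝓕 g : Lp F 2 (volume : Measure E)) =ᵐ[volume] fun ξ =>
        (2 * Real.pi * Complex.I * (inner ℝ ξ m : ℝ)) • (𝓕 f : Lp F 2 (volume : Measure E)) ξ := by
  have hgrowth : Function.HasTemperateGrowth fun ξ : E =>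
      (2 * Real.pi * Complex.I * (inner ℝ ξ m : ℝ) : ℂ) := by fun_prop
  have hfourier : 𝓕 (∂_{m} (f : 𝓢'(E, F))) = TemperedDistribution.smulLeftCLM F
      (fun ξ : E => (2 * Real.pi * Complex.I * (inner ℝ ξ m : ℝ) : ℂ)) (𝓕 (f : 𝓢'(E, F))) := by
    rw [TemperedDistribution.fourier_lineDerivOp_eq, ← smul_apply,
      ← TemperedDistribution.smulLeftCLM_smul (by fun_prop)]
    rfl
  rw [← smulLeftCLM_toTemperedDistribution_eq_iff hgrowth, ← Lp.fourier_toTemperedDistribution_eq,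
    ← Lp.fourier_toTemperedDistribution_eq, ← hfourier]
  exact (FourierTransform.fourierCLE ℂ _).injective.eq_iff.symm

theorem fourier_compLpL (A : F →L[ℂ] F') (f : Lp F 2 (volume : Measure E)) :
    𝓕 (A.compLpL 2 volume f) = A.compLpL 2 volume (𝓕 f) := by
  refine toTemperedDistribution_injective ?_
  ext ψ : 1
  simp only [← Lp.fourier_toTemperedDistribution_eq, TemperedDistribution.fourier_apply,
    compLpL_toTemperedDistribution_apply]

theorem memLp_top_fourierChar (y : E) :
    MemLp (fun ξ : E => (Real.fourierChar (inner ℝ y ξ) : ℂ)) ∞ volume :=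
  memLp_top_of_bound (Continuous.aestronglyMeasurable (by fun_prop)) 1
    (Filter.Eventually.of_forall fun _ => (Circle.norm_coe _).le)

theorem fourier_translateLp_toLp (y : E) (g : 𝓢(E, F)) :
    𝓕 (translateLp y (g.toLp 2 : Lp F 2 (volume : Measure E))) =
      smulCLM (memLp_top_fourierChar y) (𝓕 (g.toLp 2 : Lp F 2 (volume : Measure E))) := by
  rw [translateLp_toLp, SchwartzMap.toLp_fourier_eq, SchwartzMap.toLp_fourier_eq]
  refine Lp.ext ?_
  filter_upwards [coeFn_smulCLM (memLp_top_fourierChar y) ((𝓕 g).toLp 2 : Lp F 2 volume),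
    (𝓕 g).coeFn_toLp 2 volume,
    (𝓕 (SchwartzMap.compSubConstCLM ℂ (-y) g)).coeFn_toLp 2 volume] with ξ hsmul hg hcomp
  have hshift : (SchwartzMap.compSubConstCLM ℂ (-y) g : E → F) = g ∘ fun x => x + y := by
    ext x
    rw [SchwartzMap.compSubConstCLM_apply, sub_neg_eq_add, Function.comp_apply]
  rw [hcomp, hsmul, hg, SchwartzMap.fourier_coe, SchwartzMap.fourier_coe, hshift]
  exact congrFun (VectorFourier.fourierIntegral_comp_add_right Real.fourierChar volume
    (innerₗ E) g y) ξ

theorem fourier_translateLp (y : E) (f : Lp F 2 (volume : Measure E)) :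
    𝓕 (translateLp y f) = smulCLM (memLp_top_fourierChar y) (𝓕 f) := by
  refine (SchwartzMap.denseRange_toLpCLM (p := 2) ENNReal.ofNat_ne_top).induction_on
    (p := fun f => 𝓕 (translateLp y f) = smulCLM (memLp_top_fourierChar y) (𝓕 f)) f
    (isClosed_eq ?_ ?_) (fourier_translateLp_toLp y)
  · exact (Lp.fourierTransformₗᵢ E F).continuous.comp (translateLp y).continuous
  · exact (smulCLM _).continuous.comp (Lp.fourierTransformₗᵢ E F).continuous

end FourierSide

section FreeDirac

variable {n N : ℕ} {α : Fin (n + 1) → Matrix (Fin N) (Fin N) ℂ} {z : ℂ}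

/-- The matrix `α · c = ∑ⱼ cⱼ αⱼ`, in which `β`, the last matrix of the family, does not occur. -/
noncomputable def diracDot (α : Fin (n + 1) → Matrix (Fin N) (Fin N) ℂ)
    (c : EuclideanSpace ℝ (Fin n)) : Matrix (Fin N) (Fin N) ℂ :=
  ∑ j : Fin n, (c j : ℂ) • α j.castSucc

/-- The matrix `(α · c - z)⁻¹`, written as `(|c|² - z²)⁻¹ (α · c + z)`. -/
noncomputable def diracDotResolvent (α : Fin (n + 1) → Matrix (Fin N) (Fin N) ℂ) (z : ℂ)
    (c : EuclideanSpace ℝ (Fin n)) : Matrix (Fin N) (Fin N) ℂ :=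
  (((‖c‖ ^ 2 : ℝ) : ℂ) - z ^ 2)⁻¹ • (diracDot α c + z • 1)

theorem ofReal_sq_sub_sq_ne_zero (hz : z.im ≠ 0) (t : ℝ) : ((t ^ 2 : ℝ) : ℂ) - z ^ 2 ≠ 0 := by
  rw [Complex.ofReal_pow, sq_sub_sq]
  refine mul_ne_zero (fun h => hz ?_) (fun h => hz ?_) <;> simpa using congrArg Complex.im h

theorem continuous_diracDot : Continuous (diracDot α) := by
  unfold diracDot
  fun_prop

theorem continuous_diracDotResolvent (hz : z.im ≠ 0) : Continuous (diracDotResolvent α z) := by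
  have := continuous_diracDot (α := α)
  unfold diracDotResolvent
  exact (Continuous.inv₀ (by fun_prop) fun c => ofReal_sq_sub_sq_ne_zero hz _).smul (by fun_prop)

namespace IsDiracFamily

theorem isHermitian_diracDot (hα : IsDiracFamily α) (c : EuclideanSpace ℝ (Fin n)) :
    (diracDot α c).IsHermitian := by
  rw [Matrix.IsHermitian, diracDot, Matrix.conjTranspose_sum]
  refine Finset.sum_congr rfl fun j _ => ?_
  rw [Matrix.conjTranspose_smul, (hα.1 _).eq, Complex.star_def, Complex.conj_ofReal]

theorem diracDot_mul_add_mul (hα : IsDiracFamily α) (c d : EuclideanSpace ℝ (Fin n)) :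
    diracDot α c * diracDot α d + diracDot α d * diracDot α c =
      (2 * (inner ℝ c d : ℝ) : ℂ) • 1 := by
  have hanti (j k : Fin n) : ((c j : ℂ) • α j.castSucc) * ((d k : ℂ) • α k.castSucc) +
      ((d k : ℂ) • α k.castSucc) * ((c j : ℂ) • α j.castSucc) =
        if j = k then (2 * (d j * c j : ℝ) : ℂ) • 1 else 0 := by
    rw [smul_mul_smul_comm, smul_mul_smul_comm, mul_comm (c j : ℂ), ← smul_add, hα.2]
    rcases eq_or_ne j k with rfl | hjk
    · simp only [if_true, smul_smul, Complex.ofReal_mul, mul_comm (2 : ℂ)]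
    · rw [if_neg hjk, if_neg ((Fin.castSucc_injective n).ne hjk), smul_zero]
  rw [diracDot, diracDot, Finset.sum_mul_sum, Finset.sum_mul_sum,
    Finset.sum_comm (f := fun j k => ((d j : ℂ) • α j.castSucc) * ((c k : ℂ) • α k.castSucc))]
  simp only [← Finset.sum_add_distrib, hanti, Finset.sum_ite_eq, Finset.mem_univ, if_true]
  rw [← Finset.sum_smul, ← Finset.mul_sum, ← Complex.ofReal_sum]
  rfl

theorem diracDot_mul_self (hα : IsDiracFamily α) (c : EuclideanSpace ℝ (Fin n)) :
    diracDot α c * diracDot α c = ((‖c‖ ^ 2 : ℝ) : ℂ) • 1 := by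
  have h := hα.diracDot_mul_add_mul c c
  rw [← two_smul ℂ, real_inner_self_eq_norm_sq, mul_smul] at h
  exact smul_right_injective _ (two_ne_zero : (2 : ℂ) ≠ 0) h

theorem isSymmetric_diracDot (hα : IsDiracFamily α) (c : EuclideanSpace ℝ (Fin n)) :
    (Matrix.toEuclideanCLM (𝕜 := ℂ) (diracDot α c) :
      EuclideanSpace ℂ (Fin N) →ₗ[ℂ] EuclideanSpace ℂ (Fin N)).IsSymmetric :=
  Matrix.isSymmetric_toEuclideanLin_iff.mpr (hα.isHermitian_diracDot c)

theorem norm_diracDot_apply (hα : IsDiracFamily α) (c : EuclideanSpace ℝ (Fin n))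
    (v : EuclideanSpace ℂ (Fin N)) :
    ‖Matrix.toEuclideanCLM (𝕜 := ℂ) (diracDot α c) v‖ = ‖c‖ * ‖v‖ := by
  set A := Matrix.toEuclideanCLM (𝕜 := ℂ) (diracDot α c)
  have hAA : A (A v) = ((‖c‖ ^ 2 : ℝ) : ℂ) • v := by
    rw [← mul_apply_eq_comp, ← map_mul, hα.diracDot_mul_self, map_smul, map_one, smul_apply,
      one_apply_eq_self]
  have hinner : inner ℂ (A v) (A v) = ((‖c‖ ^ 2 : ℝ) : ℂ) * inner ℂ v v := by
    rw [← inner_smul_right, ← hAA]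
    exact hα.isSymmetric_diracDot c v (A v)
  refine (sq_eq_sq₀ (norm_nonneg _) (by positivity)).mp (Complex.ofReal_injective ?_)
  rw [inner_self_eq_norm_sq_to_K, inner_self_eq_norm_sq_to_K] at hinner
  push_cast at hinner ⊢
  rw [mul_pow]
  exact hinner

theorem diracDot_mul_diracDotResolvent (hα : IsDiracFamily α) (hz : z.im ≠ 0)
    (c : EuclideanSpace ℝ (Fin n)) :
    diracDot α c * diracDotResolvent α z c = 1 + z • diracDotResolvent α z c := by
  rw [← sub_eq_iff_eq_add]
  calc diracDot α c * diracDotResolvent α z c - z • diracDotResolvent α z c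
      = (((‖c‖ ^ 2 : ℝ) : ℂ) - z ^ 2)⁻¹ • (diracDot α c * diracDot α c - z ^ 2 • 1) := by
        rw [diracDotResolvent, mul_smul_comm, smul_comm z, ← smul_sub, mul_add, add_comm,
          mul_smul_comm, mul_one, smul_add, smul_smul, ← sq z, add_sub_add_left_eq_sub]
    _ = 1 := by
        rw [hα.diracDot_mul_self, ← sub_smul, inv_smul_smul₀ (ofReal_sq_sub_sq_ne_zero hz _)]

theorem diracDot_diracDotResolvent_apply (hα : IsDiracFamily α) (hz : z.im ≠ 0)
    (c : EuclideanSpace ℝ (Fin n)) (v : EuclideanSpace ℂ (Fin N)) :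
    Matrix.toEuclideanCLM (𝕜 := ℂ) (diracDot α c)
      (Matrix.toEuclideanCLM (𝕜 := ℂ) (diracDotResolvent α z c) v) =
        v + z • Matrix.toEuclideanCLM (𝕜 := ℂ) (diracDotResolvent α z c) v := by
  rw [← mul_apply_eq_comp, ← map_mul, hα.diracDot_mul_diracDotResolvent hz, map_add, map_one,
    map_smul, add_apply, one_apply_eq_self, smul_apply]

theorem norm_diracDotResolvent_le (hα : IsDiracFamily α) (hz : z.im ≠ 0)
    (c : EuclideanSpace ℝ (Fin n)) :
    ‖Matrix.toEuclideanCLM (𝕜 := ℂ) (diracDotResolvent α z c)‖ ≤ |z.im|⁻¹ := by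
  refine ContinuousLinearMap.opNorm_le_bound _ (by positivity) fun v => ?_
  have hbound := abs_im_mul_norm_le_norm_sub_smul
    ((hα.isSymmetric_diracDot c).im_inner_self_apply
      (Matrix.toEuclideanCLM (𝕜 := ℂ) (diracDotResolvent α z c) v)) z
  rw [ContinuousLinearMap.coe_coe, hα.diracDot_diracDotResolvent_apply hz,
    add_sub_cancel_right] at hbound
  rwa [inv_mul_eq_div, le_div_iff₀ (abs_pos.mpr hz), mul_comm]

theorem norm_mul_norm_diracDotResolvent_le (hα : IsDiracFamily α) (hz : z.im ≠ 0)
    (c : EuclideanSpace ℝ (Fin n)) :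
    ‖c‖ * ‖Matrix.toEuclideanCLM (𝕜 := ℂ) (diracDotResolvent α z c)‖ ≤ 1 + ‖z‖ * |z.im|⁻¹ := by
  rw [← norm_norm c, ← norm_smul]
  refine ContinuousLinearMap.opNorm_le_bound _ (by positivity) fun v => ?_
  rw [smul_apply, norm_smul, norm_norm, ← hα.norm_diracDot_apply,
    hα.diracDot_diracDotResolvent_apply hz, add_mul, one_mul, mul_assoc]
  refine (norm_add_le _ _).trans ?_
  rw [norm_smul]
  gcongr
  exact ContinuousLinearMap.le_of_opNorm_le _ (hα.norm_diracDotResolvent_le hz c) v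

theorem memLp_diracDotResolvent (hα : IsDiracFamily α) (hz : z.im ≠ 0) (l m : Fin N) :
    MemLp (fun ξ : EuclideanSpace ℝ (Fin n) => diracDotResolvent α z ((2 * Real.pi) • ξ) l m) ∞
      volume := by
  have := continuous_diracDotResolvent (α := α) hz
  exact memLp_top_of_bound (Continuous.aestronglyMeasurable (by fun_prop)) |z.im|⁻¹
    (Filter.Eventually.of_forall fun ξ => (norm_entry_le_norm_toEuclideanCLM _ l m).trans
      (hα.norm_diracDotResolvent_le hz _))

theorem memLp_mul_diracDotResolvent (hα : IsDiracFamily α) (hz : z.im ≠ 0) (j : Fin n)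
    (l m : Fin N) :
    MemLp (fun ξ : EuclideanSpace ℝ (Fin n) =>
      ((2 * Real.pi * Complex.I * ξ j : ℂ) • diracDotResolvent α z ((2 * Real.pi) • ξ)) l m) ∞
        volume := by
  have := continuous_diracDotResolvent (α := α) hz
  refine memLp_top_of_bound (Continuous.aestronglyMeasurable (by fun_prop))
    (1 + ‖z‖ * |z.im|⁻¹) (Filter.Eventually.of_forall fun ξ => ?_)
  calc ‖((2 * Real.pi * Complex.I * ξ j : ℂ) • diracDotResolvent α z ((2 * Real.pi) • ξ)) l m‖
      = ‖((2 * Real.pi) • ξ) j‖ * ‖diracDotResolvent α z ((2 * Real.pi) • ξ) l m‖ := by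
        simp [Matrix.smul_apply, norm_mul]
    _ ≤ ‖(2 * Real.pi) • ξ‖ *
          ‖Matrix.toEuclideanCLM (𝕜 := ℂ) (diracDotResolvent α z ((2 * Real.pi) • ξ))‖ := by
        gcongr
        · exact PiLp.norm_apply_le _ j
        · exact norm_entry_le_norm_toEuclideanCLM _ l m
    _ ≤ 1 + ‖z‖ * |z.im|⁻¹ := hα.norm_mul_norm_diracDotResolvent_le hz _

end IsDiracFamily

open FourierTransform

theorem hasWeakPartial_iff_fourier {j : Fin n} {f g : SpinorL2 n N} :
    HasWeakPartial j f g ↔ (𝓕 g : SpinorL2 n N) =ᵐ[volume] fun ξ =>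
      (2 * Real.pi * Complex.I * ξ j) • (𝓕 f : SpinorL2 n N) ξ := by
  rw [HasWeakPartial, lineDerivOp_toTemperedDistribution_eq_iff_fourier]
  simp only [EuclideanSpace.inner_single_right, one_mul, conj_trivial]

theorem hasWeakPartial_weakPartial (j : Fin n) (f : sobolevW12 n N) :
    HasWeakPartial j (f : SpinorL2 n N) (weakPartial j f) :=
  (f.2 j).choose_spec

theorem freeDirac_apply (f : (freeDirac α).domain) :
    freeDirac α f = ∑ j : Fin n, (Matrix.toEuclideanCLM (𝕜 := ℂ) (α j.castSucc)).compLpL 2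
      (volume : Measure (EuclideanSpace ℝ (Fin n))) ((-Complex.I) • weakPartial j f) :=
  LinearMap.sum_apply (M := sobolevW12 n N) ..

theorem fourier_freeDirac (f : (freeDirac α).domain) :
    (𝓕 (freeDirac α f) : SpinorL2 n N) =ᵐ[volume] fun ξ => Matrix.toEuclideanCLM (𝕜 := ℂ)
      (diracDot α ((2 * Real.pi) • ξ)) ((𝓕 (f : SpinorL2 n N) : SpinorL2 n N) ξ) := by
  have hterm (j : Fin n) : ∀ᵐ ξ, (𝓕 ((Matrix.toEuclideanCLM (𝕜 := ℂ) (α j.castSucc)).compLpL 2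
      (volume : Measure (EuclideanSpace ℝ (Fin n))) ((-Complex.I) • weakPartial j f)) :
        SpinorL2 n N) ξ = ((((2 * Real.pi) • ξ) j : ℝ) : ℂ) •
          Matrix.toEuclideanCLM (𝕜 := ℂ) (α j.castSucc) ((𝓕 (f : SpinorL2 n N) :) ξ) := by
    rw [fourier_compLpL, FourierTransform.fourier_smul]
    filter_upwards [(Matrix.toEuclideanCLM (𝕜 := ℂ) (α j.castSucc)).coeFn_compLpL (p := 2)
      (μ := volume) ((-Complex.I) • 𝓕 (weakPartial j f)),
      Lp.coeFn_smul (-Complex.I) (𝓕 (weakPartial j f) : SpinorL2 n N),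
      hasWeakPartial_iff_fourier.mp (hasWeakPartial_weakPartial j f)] with ξ hcomp hsmul hpartial
    rw [hcomp, hsmul, Pi.smul_apply, hpartial, smul_smul, map_smul]
    congr 1
    simp only [PiLp.smul_apply, smul_eq_mul, Complex.ofReal_mul, Complex.ofReal_ofNat]
    linear_combination (-2 * Real.pi * ξ j) * Complex.I_mul_I
  have hsum : (𝓕 (freeDirac α f) : SpinorL2 n N) = ∑ j : Fin n,
      𝓕 ((Matrix.toEuclideanCLM (𝕜 := ℂ) (α j.castSucc)).compLpL 2
        (volume : Measure (EuclideanSpace ℝ (Fin n))) ((-Complex.I) • weakPartial j f)) := by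
    rw [freeDirac_apply]
    exact map_sum (Lp.fourierTransformₗᵢ _ _) _ _
  rw [hsum]
  filter_upwards [Lp.coeFn_fun_finsetSum Finset.univ fun j : Fin n =>
    (𝓕 ((Matrix.toEuclideanCLM (𝕜 := ℂ) (α j.castSucc)).compLpL 2
      (volume : Measure (EuclideanSpace ℝ (Fin n))) ((-Complex.I) • weakPartial j f)) :
        SpinorL2 n N), ae_all_iff.mpr hterm] with ξ hcoe hξ
  rw [hcoe, Finset.sum_congr rfl fun j _ => hξ j, diracDot, map_sum, sum_apply]
  simp only [map_smul, smul_apply]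

theorem IsDiracFamily.isFormalAdjoint_freeDirac (hα : IsDiracFamily α) :
    (freeDirac α).IsFormalAdjoint (freeDirac α) := fun f g => by
  rw [← Lp.inner_fourier_eq, ← Lp.inner_fourier_eq (f : SpinorL2 n N), L2.inner_def, L2.inner_def]
  refine integral_congr_ae ?_
  filter_upwards [fourier_freeDirac f, fourier_freeDirac g] with ξ hf hg
  rw [hf, hg]
  exact hα.isSymmetric_diracDot _ _ _

/-- The free resolvent `(H₀ - z)⁻¹`, as a Fourier multiplier. -/
noncomputable def freeResolvent (hα : IsDiracFamily α) (hz : z.im ≠ 0) :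
    SpinorL2 n N →L[ℂ] SpinorL2 n N :=
  let 𝓕₂ := Lp.fourierTransformₗᵢ (EuclideanSpace ℝ (Fin n)) (EuclideanSpace ℂ (Fin N))
  (𝓕₂.symm : SpinorL2 n N →L[ℂ] SpinorL2 n N) ∘L mulCLM _ (hα.memLp_diracDotResolvent hz) ∘L
    (𝓕₂ : SpinorL2 n N →L[ℂ] SpinorL2 n N)

theorem fourier_freeResolvent (hα : IsDiracFamily α) (hz : z.im ≠ 0) (f : SpinorL2 n N) :
    (𝓕 (freeResolvent hα hz f) : SpinorL2 n N) =ᵐ[volume] fun ξ => Matrix.toEuclideanCLM (𝕜 := ℂ)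
      (diracDotResolvent α z ((2 * Real.pi) • ξ)) ((𝓕 f : SpinorL2 n N) ξ) := by
  have h : (𝓕 (freeResolvent hα hz f) : SpinorL2 n N) =
      mulCLM _ (hα.memLp_diracDotResolvent hz) (𝓕 f) :=
    (Lp.fourierTransformₗᵢ (EuclideanSpace ℝ (Fin n)) (EuclideanSpace ℂ (Fin N))).apply_symm_apply _
  rw [h]
  exact coeFn_mulCLM _ _

theorem freeResolvent_mem_domain (hα : IsDiracFamily α) (hz : z.im ≠ 0) (f : SpinorL2 n N) :
    freeResolvent hα hz f ∈ (freeDirac α).domain := fun j => by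
  refine ⟨𝓕⁻ (mulCLM _ (hα.memLp_mul_diracDotResolvent hz j) (𝓕 f)), ?_⟩
  rw [hasWeakPartial_iff_fourier, fourier_fourierInv_eq]
  filter_upwards [coeFn_mulCLM (hα.memLp_mul_diracDotResolvent hz j) (𝓕 f),
    fourier_freeResolvent hα hz f] with ξ hmul hR
  rw [hmul, hR, map_smul, smul_apply]

theorem isResolvent_freeResolvent (hα : IsDiracFamily α) (hz : z.im ≠ 0) :
    IsResolvent (freeDirac α) z (freeResolvent hα hz) := by
  refine IsResolvent.of_right_inverse_of_isFormalAdjoint_self hz hα.isFormalAdjoint_freeDirac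
    fun f => ⟨freeResolvent_mem_domain hα hz f, ?_⟩
  set g : (freeDirac α).domain := ⟨freeResolvent hα hz f, freeResolvent_mem_domain hα hz f⟩
  have hadd : freeDirac α g = f + z • (g : SpinorL2 n N) := by
    refine (Lp.fourierTransformₗᵢ _ _).injective ?_
    rw [map_add, map_smul]
    refine Lp.ext ?_
    filter_upwards [Lp.coeFn_add (𝓕 f) (z • 𝓕 (g : SpinorL2 n N) : SpinorL2 n N),
      Lp.coeFn_smul z (𝓕 (g : SpinorL2 n N) : SpinorL2 n N), fourier_freeDirac g,
      fourier_freeResolvent hα hz f] with ξ hadd hsmul hg hR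
    refine hg.trans (Eq.trans ?_ hadd.symm)
    rw [Pi.add_apply, hsmul, Pi.smul_apply, hR, hα.diracDot_diracDotResolvent_apply hz]
  rw [hadd, add_sub_cancel_right]

theorem norm_fourierChar_inner_sub_one_le {E : Type*} [NormedAddCommGroup E]
    [InnerProductSpace ℝ E] (y ξ : E) :
    ‖(Real.fourierChar (inner ℝ y ξ) : ℂ) - 1‖ ≤ ‖y‖ * ‖(2 * Real.pi) • ξ‖ := by
  rw [Real.fourierChar_apply, mul_comm _ Complex.I, ← real_inner_smul_right]
  exact Real.norm_exp_I_mul_ofReal_sub_one_le.trans (norm_inner_le_norm _ _)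

theorem IsDiracFamily.norm_translateLp_sub_le (hα : IsDiracFamily α)
    (y : EuclideanSpace ℝ (Fin n)) (f : (freeDirac α).domain) :
    ‖translateLp y (f : SpinorL2 n N) - f‖ ≤ ‖y‖ * ‖freeDirac α f‖ := by
  have hsub : (𝓕 (translateLp y (f : SpinorL2 n N) - f) : SpinorL2 n N) =
      𝓕 (translateLp y (f : SpinorL2 n N)) - 𝓕 (f : SpinorL2 n N) :=
    map_sub (Lp.fourierTransformₗᵢ _ _) _ _
  rw [← Lp.norm_fourier_eq, ← Lp.norm_fourier_eq (freeDirac α f), hsub, fourier_translateLp]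
  refine Lp.norm_le_mul_norm_of_ae_le_mul ?_
  filter_upwards [Lp.coeFn_sub (smulCLM (memLp_top_fourierChar y) (𝓕 (f : SpinorL2 n N)))
    (𝓕 (f : SpinorL2 n N)), coeFn_smulCLM (memLp_top_fourierChar y) (𝓕 (f : SpinorL2 n N)),
    fourier_freeDirac f] with ξ hsub hsmul hf
  have hfactor : (Real.fourierChar (inner ℝ y ξ) : ℂ) • (𝓕 (f : SpinorL2 n N) :) ξ -
      (𝓕 (f : SpinorL2 n N) :) ξ =
        ((Real.fourierChar (inner ℝ y ξ) : ℂ) - 1) • (𝓕 (f : SpinorL2 n N) :) ξ := by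
    rw [sub_smul, one_smul]
  rw [hsub, Pi.sub_apply, hsmul, hf, hα.norm_diracDot_apply, ← mul_assoc, hfactor, norm_smul]
  gcongr
  exact norm_fourierChar_inner_sub_one_le y ξ

theorem IsResolvent.norm_freeDirac_le {D R : SpinorL2 n N →L[ℂ] SpinorL2 n N}
    (h : IsResolvent ((D : SpinorL2 n N →ₗ[ℂ] SpinorL2 n N) +ᵥ freeDirac α) z R)
    (f : SpinorL2 n N) :
    ‖freeDirac α ⟨R f, h.mem_domain f⟩‖ ≤ (1 + (‖z‖ + ‖D‖) * ‖R‖) * ‖f‖ := by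
  have heq : freeDirac α ⟨R f, h.mem_domain f⟩ = f + z • R f - D (R f) :=
    eq_sub_of_add_eq' (sub_eq_iff_eq_add.mp (h.apply_sub f))
  calc ‖freeDirac α ⟨R f, h.mem_domain f⟩‖ ≤ ‖f‖ + ‖z‖ * ‖R f‖ + ‖D‖ * ‖R f‖ := by
        rw [heq]
        refine (norm_sub_le _ _).trans (add_le_add ((norm_add_le _ _).trans_eq ?_) (D.le_opNorm _))
        rw [norm_smul]
    _ = ‖f‖ + (‖z‖ + ‖D‖) * ‖R f‖ := by ring
    _ ≤ ‖f‖ + (‖z‖ + ‖D‖) * (‖R‖ * ‖f‖) := by gcongr; exact R.le_opNorm f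
    _ = (1 + (‖z‖ + ‖D‖) * ‖R‖) * ‖f‖ := by ring

theorem IsResolvent.norm_translateLp_sub_le (hα : IsDiracFamily α)
    {D R : SpinorL2 n N →L[ℂ] SpinorL2 n N}
    (h : IsResolvent ((D : SpinorL2 n N →ₗ[ℂ] SpinorL2 n N) +ᵥ freeDirac α) z R)
    (y : EuclideanSpace ℝ (Fin n)) (f : SpinorL2 n N) :
    ‖translateLp y (R f) - R f‖ ≤ ‖y‖ * ((1 + (‖z‖ + ‖D‖) * ‖R‖) * ‖f‖) :=
  (hα.norm_translateLp_sub_le y ⟨R f, h.mem_domain f⟩).trans <| by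
    gcongr
    exact h.norm_freeDirac_le f

end FreeDirac

section ProductRule

theorem hasTemperateGrowth_fderiv {E F : Type*} [NormedAddCommGroup E] [NormedSpace ℝ E]
    [NormedAddCommGroup F] [NormedSpace ℝ F] {φ : E → F} (hφ : φ.HasTemperateGrowth) :
    (fderiv ℝ φ).HasTemperateGrowth :=
  ⟨hφ.1.fderiv_right le_rfl, fun m =>
    (hφ.2 (m + 1)).imp fun _ => Exists.imp fun _ h x => norm_iteratedFDeriv_fderiv.trans_le (h x)⟩

theorem hasTemperateGrowth_fderiv_apply {E F : Type*} [NormedAddCommGroup E] [NormedSpace ℝ E]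
    [NormedAddCommGroup F] [NormedSpace ℝ F] {φ : E → F} (hφ : φ.HasTemperateGrowth) (m : E) :
    Function.HasTemperateGrowth fun x => fderiv ℝ φ x m :=
  (ContinuousLinearMap.apply ℝ F m).hasTemperateGrowth.comp (hasTemperateGrowth_fderiv hφ)

theorem lineDerivOp_smulLeftCLM {E F : Type*} [NormedAddCommGroup E] [NormedSpace ℝ E]
    [NormedAddCommGroup F] [NormedSpace ℂ F] {φ : E → ℂ} (hφ : φ.HasTemperateGrowth) (m : E)
    (u : 𝓢'(E, F)) :
    ∂_{m} (TemperedDistribution.smulLeftCLM F φ u) =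
      TemperedDistribution.smulLeftCLM F φ (∂_{m} u) +
        TemperedDistribution.smulLeftCLM F (fun x => fderiv ℝ φ x m) u := by
  ext ψ : 1
  have hφ' := hasTemperateGrowth_fderiv_apply hφ m
  simp only [add_apply, TemperedDistribution.lineDerivOp_apply_apply,
    TemperedDistribution.smulLeftCLM_apply_apply, ← map_add]
  congr 1
  ext x
  have hdφ : DifferentiableAt ℝ φ x := hφ.1.differentiable (by simp) x
  simp only [map_neg, neg_apply, add_apply, SchwartzMap.smulLeftCLM_apply_apply hφ,
    SchwartzMap.smulLeftCLM_apply_apply hφ', SchwartzMap.lineDerivOp_apply_eq_fderiv,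
    SchwartzMap.smulLeftCLM_apply hφ]
  rw [fderiv_fun_smul hdφ ψ.differentiableAt, add_apply, smul_apply,
    ContinuousLinearMap.smulRight_apply, neg_add_rev, neg_add_cancel_comm]

variable {n N : ℕ} {α : Fin (n + 1) → Matrix (Fin N) (Fin N) ℂ}

theorem HasWeakPartial.smulCLM {j : Fin n} {φ θ : EuclideanSpace ℝ (Fin n) → ℂ}
    (hφ : φ.HasTemperateGrowth) (hφ' : MemLp φ ∞ volume) (hθ : MemLp θ ∞ volume)
    (hd : ∀ x, fderiv ℝ φ x (EuclideanSpace.single j 1) = φ x * θ x) {f g : SpinorL2 n N}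
    (h : HasWeakPartial j f g) :
    HasWeakPartial j (_root_.smulCLM hφ' f) (_root_.smulCLM hφ' (g + _root_.smulCLM hθ f)) := by
  unfold HasWeakPartial at *
  rw [← smulLeftCLM_toTemperedDistribution_of_ae_eq hφ (coeFn_smulCLM hφ' f),
    lineDerivOp_smulLeftCLM hφ, h, map_add, spinor_toTempered_add,
    ← smulLeftCLM_toTemperedDistribution_of_ae_eq hφ (coeFn_smulCLM hφ' g)]
  congr 1
  refine smulLeftCLM_toTemperedDistribution_of_ae_eq (hasTemperateGrowth_fderiv_apply hφ _) ?_
  filter_upwards [coeFn_smulCLM hφ' (_root_.smulCLM hθ f), coeFn_smulCLM hθ f] with x hφx hθx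
  rw [hφx, hθx, smul_smul, hd]

variable {v : EuclideanSpace ℝ (Fin n) → EuclideanSpace ℝ (Fin n)}

theorem memLp_smul_diracDot (hv : ∀ j, MemLp (fun x => (v x j : ℂ)) ∞ volume) (l m : Fin N) :
    MemLp (fun x => ((-Complex.I) • diracDot α (v x)) l m) ∞ volume := by
  simp only [diracDot, Matrix.smul_apply, Matrix.sum_apply, smul_eq_mul]
  exact (memLp_finsetSum _ fun j _ => (hv j).mul_const (α j.castSucc l m)).const_mul _

/-- Multiplication by the matrix-valued function `-i α · v`, for a bounded vector field `v`. For
`v = ∇ log w` it is the difference between `w⁻¹ H₀ w` and `H₀`. -/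
noncomputable def diracDotCLM (α : Fin (n + 1) → Matrix (Fin N) (Fin N) ℂ)
    (hv : ∀ j, MemLp (fun x => (v x j : ℂ)) ∞ volume) : SpinorL2 n N →L[ℂ] SpinorL2 n N :=
  mulCLM (fun x => (-Complex.I) • diracDot α (v x)) (memLp_smul_diracDot hv)

theorem norm_diracDotCLM_le (hα : IsDiracFamily α)
    (hv : ∀ j, MemLp (fun x => (v x j : ℂ)) ∞ volume) {c : ℝ} (h : ∀ x, ‖v x‖ ≤ c) :
    ‖diracDotCLM α hv‖ ≤ c := by
  have hc : 0 ≤ c := (norm_nonneg _).trans (h 0)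
  refine norm_mulCLM_le _ hc (.of_forall fun x => ?_)
  refine ContinuousLinearMap.opNorm_le_bound _ hc fun w => ?_
  rw [map_smul, smul_apply, norm_smul, norm_neg, Complex.norm_I, one_mul, hα.norm_diracDot_apply]
  gcongr
  exact h x

theorem diracDotCLM_apply (hv : ∀ j, MemLp (fun x => (v x j : ℂ)) ∞ volume) (f : SpinorL2 n N) :
    diracDotCLM α hv f = ∑ j : Fin n, (Matrix.toEuclideanCLM (𝕜 := ℂ) (α j.castSucc)).compLpL 2
      (volume : Measure (EuclideanSpace ℝ (Fin n))) ((-Complex.I) • smulCLM (hv j) f) := by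
  refine Lp.ext ?_
  have hterm (j : Fin n) : ∀ᵐ x, (Matrix.toEuclideanCLM (𝕜 := ℂ) (α j.castSucc)).compLpL 2
      (volume : Measure (EuclideanSpace ℝ (Fin n))) ((-Complex.I) • smulCLM (hv j) f) x =
        (-Complex.I) • (v x j : ℂ) • Matrix.toEuclideanCLM (𝕜 := ℂ) (α j.castSucc) (f x) := by
    filter_upwards [(Matrix.toEuclideanCLM (𝕜 := ℂ) (α j.castSucc)).coeFn_compLpL
      ((-Complex.I) • smulCLM (hv j) f), Lp.coeFn_smul (-Complex.I) (smulCLM (hv j) f),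
      coeFn_smulCLM (hv j) f] with x hA hI hvx
    rw [hA, hI, Pi.smul_apply, hvx, map_smul, map_smul]
  filter_upwards [coeFn_mulCLM (memLp_smul_diracDot (α := α) hv) f, ae_all_iff.mpr hterm,
    Lp.coeFn_fun_finsetSum Finset.univ fun j : Fin n =>
      (Matrix.toEuclideanCLM (𝕜 := ℂ) (α j.castSucc)).compLpL 2
        (volume : Measure (EuclideanSpace ℝ (Fin n))) ((-Complex.I) • smulCLM (hv j) f)]
    with x hmul hx hsum
  rw [diracDotCLM, hmul, hsum, diracDot, Finset.sum_congr rfl fun j _ => hx j]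
  simp only [map_smul, map_sum, smul_apply, sum_apply, Finset.smul_sum]

theorem freeDirac_smulCLM {w : EuclideanSpace ℝ (Fin n) → ℝ} (hw : w.HasTemperateGrowth)
    (hw' : MemLp (fun x => (w x : ℂ)) ∞ volume)
    (hv : ∀ j, MemLp (fun x => (v x j : ℂ)) ∞ volume)
    (hgrad : ∀ x, HasGradientAt w (w x • v x) x) (f : (freeDirac α).domain) :
    ∃ h : smulCLM hw' (f : SpinorL2 n N) ∈ (freeDirac α).domain,
      freeDirac α ⟨smulCLM hw' (f : SpinorL2 n N), h⟩ =
        smulCLM hw' (freeDirac α f + diracDotCLM α hv f) := by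
  have hd (j : Fin n) (x) : fderiv ℝ (fun x => (w x : ℂ)) x (EuclideanSpace.single j 1) =
      (w x : ℂ) * (v x j : ℂ) := by
    have hfderiv := (Complex.ofRealCLM.hasFDerivAt.comp x (hgrad x).hasFDerivAt).fderiv
    simpa [Function.comp_def, EuclideanSpace.inner_single_right] using
      DFunLike.congr_fun hfderiv (EuclideanSpace.single j 1)
  have hpartial (j : Fin n) := (hasWeakPartial_weakPartial j f).smulCLM
    (Complex.ofRealCLM.hasTemperateGrowth.comp hw) hw' (hv j) (hd j)
  have hmem : smulCLM hw' (f : SpinorL2 n N) ∈ (freeDirac α).domain := fun j => ⟨_, hpartial j⟩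
  have hfree : freeDirac α ⟨smulCLM hw' (f : SpinorL2 n N), hmem⟩ = ∑ j : Fin n,
      (Matrix.toEuclideanCLM (𝕜 := ℂ) (α j.castSucc)).compLpL 2
        (volume : Measure (EuclideanSpace ℝ (Fin n)))
          ((-Complex.I) • smulCLM hw' (weakPartial j f + smulCLM (hv j) (f : SpinorL2 n N))) :=
    (freeDirac_apply _).trans <| Finset.sum_congr rfl fun j _ => congrArg _ <| congrArg _ <|
      (hasWeakPartial_weakPartial j ⟨_, hmem⟩).unique (hpartial j)
  refine ⟨hmem, ?_⟩
  rw [hfree, freeDirac_apply, diracDotCLM_apply, ← Finset.sum_add_distrib, map_sum]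
  refine Finset.sum_congr rfl fun j _ => ?_
  rw [← map_smul, compLpL_smulCLM, smul_add, map_add]

end ProductRule

section Weights

/-- The weight `⟨εx⟩⁻ˢ`, where `⟨y⟩ = (1 + |y|²)^(1/2)`. -/
noncomputable def japaneseWeight {E : Type*} [NormedAddCommGroup E] [NormedSpace ℝ E] (ε s : ℝ)
    (x : E) : ℝ :=
  (1 + ‖ε • x‖ ^ 2) ^ (-s / 2)

section Pointwise

variable {E : Type*} [NormedAddCommGroup E] [NormedSpace ℝ E]

theorem japaneseWeight_pos (ε s : ℝ) (x : E) : 0 < japaneseWeight ε s x := by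
  unfold japaneseWeight
  positivity

theorem japaneseWeight_zero (ε : ℝ) (x : E) : japaneseWeight ε 0 x = 1 := by
  rw [japaneseWeight, neg_zero, zero_div, Real.rpow_zero]

theorem japaneseWeight_add (ε s t : ℝ) (x : E) :
    japaneseWeight ε (s + t) x = japaneseWeight ε s x * japaneseWeight ε t x := by
  rw [japaneseWeight, neg_add, add_div, Real.rpow_add (by positivity), japaneseWeight,
    japaneseWeight]

theorem japaneseWeight_le_one (ε : ℝ) {s : ℝ} (hs : 0 ≤ s) (x : E) : japaneseWeight ε s x ≤ 1 :=
  Real.rpow_le_one_of_one_le_of_nonpos (by nlinarith [sq_nonneg ‖ε • x‖]) (by linarith)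

end Pointwise

section Gradient

variable {E : Type*} [NormedAddCommGroup E] [InnerProductSpace ℝ E]

theorem hasTemperateGrowth_japaneseWeight (ε s : ℝ) :
    (japaneseWeight ε s : E → ℝ).HasTemperateGrowth := by
  have h₁ : (fun x : E => (1 + ‖x‖ ^ 2) ^ (-s / 2)).HasTemperateGrowth := by fun_prop
  exact h₁.comp (ε • ContinuousLinearMap.id ℝ E).hasTemperateGrowth

/-- The gradient of `log ⟨εx⟩⁻ˢ`. -/
noncomputable def japaneseWeightLogGrad (ε s : ℝ) (x : E) : E :=
  (-(s * ε ^ 2 / (1 + ‖ε • x‖ ^ 2))) • x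

theorem hasGradientAt_japaneseWeight [CompleteSpace E] (ε s : ℝ) (x : E) :
    HasGradientAt (japaneseWeight ε s) (japaneseWeight ε s x • japaneseWeightLogGrad ε s x) x := by
  have hbase : HasFDerivAt (fun x : E => 1 + ‖ε • x‖ ^ 2) (ε ^ 2 • (2 • innerSL ℝ x)) x := by
    simpa only [norm_smul, mul_pow, Real.norm_eq_abs, sq_abs] using
      ((hasStrictFDerivAt_norm_sq x).hasFDerivAt.const_mul (ε ^ 2)).const_add 1
  have hpos : 0 < 1 + ‖ε • x‖ ^ 2 := by positivity
  have hderiv := hbase.rpow_const (p := -s / 2) (Or.inl hpos.ne')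
  rw [hasGradientAt_iff_hasFDerivAt]
  refine hderiv.congr_fderiv ?_
  ext y
  rw [Real.rpow_sub_one hpos.ne']
  simp [japaneseWeight, japaneseWeightLogGrad]
  field_simp

theorem norm_japaneseWeightLogGrad_le {ε s : ℝ} (hε : 0 ≤ ε) (hs : 0 ≤ s) (x : E) :
    ‖japaneseWeightLogGrad ε s x‖ ≤ s * ε := by
  rw [japaneseWeightLogGrad, norm_smul, norm_neg, Real.norm_of_nonneg (by positivity), norm_smul,
    Real.norm_of_nonneg hε, div_mul_eq_mul_div, div_le_iff₀ (by positivity)]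
  nlinarith [mul_nonneg (mul_nonneg hs hε) (sq_nonneg (1 - ε * ‖x‖)), mul_nonneg hs hε,
    mul_nonneg (mul_nonneg hs hε) (sq_nonneg (ε * ‖x‖))]

end Gradient

variable {n N : ℕ} {α : Fin (n + 1) → Matrix (Fin N) (Fin N) ℂ} {ε s t : ℝ}

theorem memLp_japaneseWeight (ε : ℝ) (hs : 0 ≤ s) :
    MemLp (fun x : EuclideanSpace ℝ (Fin n) => (japaneseWeight ε s x : ℂ)) ∞ volume := by
  have := (hasTemperateGrowth_japaneseWeight (E := EuclideanSpace ℝ (Fin n)) ε s).1.continuous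
  refine memLp_top_of_bound (Continuous.aestronglyMeasurable (by fun_prop)) 1
    (.of_forall fun x => ?_)
  rw [Complex.norm_real, Real.norm_of_nonneg (japaneseWeight_pos ε s x).le]
  exact japaneseWeight_le_one ε hs x

theorem memLp_japaneseWeightLogGrad (hε : 0 ≤ ε) (hs : 0 ≤ s) (j : Fin n) :
    MemLp (fun x : EuclideanSpace ℝ (Fin n) => (japaneseWeightLogGrad ε s x j : ℂ)) ∞ volume := by
  have : Continuous (japaneseWeightLogGrad ε s : EuclideanSpace ℝ (Fin n) → _) := by
    unfold japaneseWeightLogGrad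
    have hne (x : EuclideanSpace ℝ (Fin n)) : 1 + ‖ε • x‖ ^ 2 ≠ 0 := by positivity
    fun_prop (disch := exact hne _)
  refine memLp_top_of_bound (Continuous.aestronglyMeasurable (by fun_prop)) (s * ε)
    (.of_forall fun x => ?_)
  rw [Complex.norm_real]
  exact (PiLp.norm_apply_le _ j).trans (norm_japaneseWeightLogGrad_le hε hs x)

/-- Multiplication by the weight `⟨εx⟩⁻ˢ`, `s ≥ 0`, on spinors. -/
noncomputable def weightCLM (ε : ℝ) (hs : 0 ≤ s) : SpinorL2 n N →L[ℂ] SpinorL2 n N :=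
  smulCLM (memLp_japaneseWeight ε hs)

theorem weightCLM_add (hs : 0 ≤ s) (ht : 0 ≤ t) :
    (weightCLM ε (add_nonneg hs ht) : SpinorL2 n N →L[ℂ] SpinorL2 n N) =
      weightCLM ε hs * weightCLM ε ht := by
  have hst := memLp_japaneseWeight (n := n) ε (add_nonneg hs ht)
  simp only [japaneseWeight_add, Complex.ofReal_mul] at hst
  rw [weightCLM, weightCLM, weightCLM, smulCLM_mul_smulCLM _ _ hst]
  simp only [japaneseWeight_add, Complex.ofReal_mul]

/-- The bounded operator `B` in the commutation relation `H₀ W = W (H₀ + B)`, where `W` is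
multiplication by the weight `⟨εx⟩⁻ˢ`. -/
noncomputable def weightPotentialCLM (α : Fin (n + 1) → Matrix (Fin N) (Fin N) ℂ) (hε : 0 ≤ ε)
    (hs : 0 ≤ s) : SpinorL2 n N →L[ℂ] SpinorL2 n N :=
  diracDotCLM α (memLp_japaneseWeightLogGrad hε hs)

theorem norm_weightPotentialCLM_le (hα : IsDiracFamily α) (hε : 0 ≤ ε) (hs : 0 ≤ s) :
    ‖weightPotentialCLM α hε hs‖ ≤ s * ε :=
  norm_diracDotCLM_le hα _ (norm_japaneseWeightLogGrad_le hε hs)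

theorem freeDirac_weightCLM (hε : 0 ≤ ε) (hs : 0 ≤ s) (f : (freeDirac α).domain) :
    ∃ h : weightCLM ε hs (f : SpinorL2 n N) ∈ (freeDirac α).domain,
      freeDirac α ⟨weightCLM ε hs (f : SpinorL2 n N), h⟩ =
        weightCLM ε hs (freeDirac α f + weightPotentialCLM α hε hs f) :=
  freeDirac_smulCLM (hasTemperateGrowth_japaneseWeight ε s) _ _
    (hasGradientAt_japaneseWeight ε s) f

end Weights

section CellSampling

section StepFunctions

variable {X ι 𝕜 F : Type*} [MeasurableSpace X] {μ : Measure X} [MeasurableSpace ι] [Countable ι]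
  [DiscreteMeasurableSpace ι] [NontriviallyNormedField 𝕜] [NormedAddCommGroup F] [NormedSpace 𝕜 F]
  {p : ℝ≥0∞} {π : X → ι} {P : Finset ι} {φ : X → 𝕜}

theorem memLp_smul_comp_of_eq_zero (hπ : Measurable π) (hφ : MemLp φ p μ)
    (hφP : ∀ x, π x ∉ P → φ x = 0) (c : ι → F) : MemLp (fun x => φ x • c (π x)) p μ := by
  have hc : StronglyMeasurable fun x => c (π x) :=
    StronglyMeasurable.of_discrete.comp_measurable hπ
  refine hφ.of_le_mul (c := ∑ q ∈ P, ‖c q‖) (hφ.1.smul hc.aestronglyMeasurable)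
    (Filter.Eventually.of_forall fun x => ?_)
  by_cases hx : π x ∈ P
  · rw [norm_smul, mul_comm]
    gcongr
    exact Finset.single_le_sum (f := fun q => ‖c q‖) (fun q _ => norm_nonneg _) hx
  · simp [hφP x hx]

theorem exists_submodule_finrank_le_ae_eq_smul_comp [FiniteDimensional 𝕜 F] [Fact (1 ≤ p)]
    (hπ : Measurable π) (hφ : MemLp φ p μ) (hφP : ∀ x, π x ∉ P → φ x = 0) :
    ∃ U : Submodule 𝕜 (Lp F p μ), FiniteDimensional 𝕜 U ∧
      Module.finrank 𝕜 U ≤ P.card * Module.finrank 𝕜 F ∧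
      ∀ c : ι → F, ∃ g ∈ U, g =ᵐ[μ] fun x => φ x • c (π x) := by
  have hmem (c : ι → F) := memLp_smul_comp_of_eq_zero hπ hφ hφP c
  let step : (ι → F) →ₗ[𝕜] Lp F p μ :=
    { toFun c := (hmem c).toLp
      map_add' c d := by
        rw [← MemLp.toLp_add]
        exact MemLp.toLp_congr _ _ (Filter.Eventually.of_forall fun x => smul_add _ _ _)
      map_smul' a c := by
        rw [RingHom.id_apply, ← MemLp.toLp_const_smul]
        exact MemLp.toLp_congr _ _ (Filter.Eventually.of_forall fun x => smul_comm _ _ _) }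
  let extend : (P → F) →ₗ[𝕜] (ι → F) :=
    { toFun c := Function.extend Subtype.val c 0
      map_add' c d := by rw [← Function.extend_add, add_zero]
      map_smul' a c := by rw [RingHom.id_apply, ← Function.extend_smul, smul_zero] }
  refine ⟨(step ∘ₗ extend).range, inferInstance, ?_, fun c =>
    ⟨_, ⟨fun q => c q, rfl⟩, (hmem _).coeFn_toLp.trans (Filter.Eventually.of_forall fun x => ?_)⟩⟩
  · refine (LinearMap.finrank_range_le _).trans_eq ?_
    rw [Module.finrank_pi_fintype, Finset.sum_const, Finset.card_univ, Fintype.card_coe,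
      smul_eq_mul]
  · by_cases hx : π x ∈ P
    · have hext : extend (fun q => c q) (π x) = c (π x) :=
        Subtype.val_injective.extend_apply (fun q : P => c q) 0 ⟨π x, hx⟩
      simp only [hext]
    · simp only [hφP x hx, zero_smul]

end StepFunctions

section Cells

variable {n : ℕ} {s : ℝ}

theorem norm_le_mul_of_forall_abs_le {t : EuclideanSpace ℝ (Fin n)} (ht : ∀ i, |t i| ≤ s) :
    ‖t‖ ≤ n * s := by
  calc ‖t‖ ≤ ∑ i, ‖t i‖ := by
        rw [EuclideanSpace.norm_eq]
        exact Real.sqrt_le_iff.mpr ⟨by positivity,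
          Finset.sum_sq_le_sq_sum_of_nonneg fun i _ => norm_nonneg (t i)⟩
    _ ≤ n * s := by simpa using Finset.sum_le_card_nsmul Finset.univ _ s fun i _ => ht i

/-- The half-open box `∏ᵢ [a, b)`. -/
def cube (n : ℕ) (a b : ℝ) : Set (EuclideanSpace ℝ (Fin n)) := {x | ∀ i, x i ∈ Set.Ico a b}

theorem volume_cube (a b : ℝ) : volume (cube n a b) = ENNReal.ofReal (b - a) ^ n := by
  have hcube : cube n a b = WithLp.ofLp ⁻¹' Set.univ.pi fun _ => Set.Ico a b := by
    ext x
    simp [cube]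
  rw [hcube, (PiLp.volume_preserving_ofLp (Fin n)).measure_preimage
    (MeasurableSet.univ_pi fun i => measurableSet_Ico).nullMeasurableSet, Real.volume_pi_Ico,
    Finset.prod_const, Finset.card_univ, Fintype.card_fin]

theorem measurableSet_cube (a b : ℝ) : MeasurableSet (cube n a b) := by
  rw [cube, Set.ofPred_forall]
  exact MeasurableSet.iInter fun i => measurableSet_preimage (by fun_prop) measurableSet_Ico

/-- The multi-index of the cell of side `s` containing `x`. -/
noncomputable def cellIndex (s : ℝ) (x : EuclideanSpace ℝ (Fin n)) (i : Fin n) : ℤ := ⌊x i / s⌋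

/-- The lower corner of the cell of side `s` with multi-index `q`. -/
noncomputable def cellCorner (s : ℝ) (q : Fin n → ℤ) : EuclideanSpace ℝ (Fin n) :=
  WithLp.toLp 2 fun i => s * q i

theorem measurable_cellIndex (s : ℝ) :
    Measurable (cellIndex s : EuclideanSpace ℝ (Fin n) → Fin n → ℤ) :=
  measurable_pi_lambda _ fun i => Int.measurable_floor.comp (by fun_prop)

theorem sub_cellCorner_mem_cube (hs : 0 < s) (x : EuclideanSpace ℝ (Fin n)) :
    x - cellCorner s (cellIndex s x) ∈ cube n 0 s := by
  intro i
  have hle := Int.floor_le (x i / s)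
  have hlt := Int.lt_floor_add_one (x i / s)
  rw [le_div_iff₀ hs] at hle
  rw [div_lt_iff₀ hs] at hlt
  simp only [cellCorner, cellIndex, PiLp.sub_apply, Set.mem_Ico]
  constructor <;> linarith

theorem cellIndex_mem_piFinset {m : ℤ} (hs : 0 < s) {x : EuclideanSpace ℝ (Fin n)}
    (hx : ‖x‖ < m * s) : cellIndex s x ∈ Fintype.piFinset fun _ => Finset.Ico (-m) m := by
  rw [Fintype.mem_piFinset]
  intro i
  have hxi := abs_lt.mp ((PiLp.norm_apply_le x i).trans_lt hx)
  rw [Finset.mem_Ico, cellIndex, Int.le_floor, Int.floor_lt, le_div_iff₀ hs, div_lt_iff₀ hs]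
  push_cast
  constructor <;> linarith

theorem setLIntegral_cellCorner_add_le (hs : 0 < s) (x : EuclideanSpace ℝ (Fin n))
    (h : EuclideanSpace ℝ (Fin n) → ℝ≥0∞) :
    ∫⁻ v in cube n 0 s, h (cellCorner s (cellIndex s x) + v) ≤
      ∫⁻ t in cube n (-s) s, h (x + t) := by
  set r := x - cellCorner s (cellIndex s x) with hr
  have hrcube : r ∈ cube n 0 s := sub_cellCorner_mem_cube hs x
  rw [← lintegral_indicator (measurableSet_cube _ _),
    ← lintegral_indicator (measurableSet_cube _ _), ← lintegral_add_right_eq_self _ r]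
  refine lintegral_mono fun t => ?_
  by_cases ht : t + r ∈ cube n 0 s
  · have htcube : t ∈ cube n (-s) s := fun i => by
      have hti := ht i
      have hri := hrcube i
      rw [PiLp.add_apply] at hti
      exact ⟨by linarith [hti.1, hri.2], by linarith [hti.2, hri.1]⟩
    rw [Set.indicator_of_mem ht, Set.indicator_of_mem htcube, hr]
    exact (congrArg h (by abel)).le
  · rw [Set.indicator_of_notMem ht]
    exact zero_le

/-- Averaging over the position `v` of the sampling points inside the cells of side `s`. -/
theorem exists_lintegral_cellCorner_add_le (hs : 0 < s)
    {h : EuclideanSpace ℝ (Fin n) → EuclideanSpace ℝ (Fin n) → ℝ≥0∞}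
    (hh : Measurable (Function.uncurry h)) {K : ℝ≥0∞}
    (hK : ∀ t, (∀ i, |t i| ≤ s) → ∫⁻ x, h x (x + t) ≤ K) :
    ∃ v, ∫⁻ x, h x (cellCorner s (cellIndex s x) + v) ≤ 2 ^ n * K := by
  have hcorner : Measurable fun x : EuclideanSpace ℝ (Fin n) => cellCorner s (cellIndex s x) :=
    (measurable_of_countable (cellCorner s)).comp (measurable_cellIndex s)
  have hsample : Measurable (Function.uncurry fun v x =>
      h x (cellCorner s (cellIndex s x) + v)) :=
    hh.comp (measurable_snd.prodMk ((hcorner.comp measurable_snd).add measurable_fst))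
  have htranslate : Measurable (Function.uncurry fun t x => h x (x + t)) :=
    hh.comp (measurable_snd.prodMk (measurable_snd.add measurable_fst))
  have hvol : volume (cube n (-s) s) = 2 ^ n * volume (cube n 0 s) := by
    rw [volume_cube, volume_cube, ← mul_pow, sub_zero, sub_neg_eq_add, ← two_mul,
      ENNReal.ofReal_mul zero_le_two, ENNReal.ofReal_ofNat]
  have hvol_ne_zero : volume (cube n 0 s) ≠ 0 := by simp [volume_cube, hs]
  have hvol_ne_top : volume (cube n 0 s) ≠ ∞ := by simp [volume_cube]
  obtain ⟨v, -, hv⟩ := exists_le_setLAverage hvol_ne_zero hvol_ne_top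
    (hsample.lintegral_prod_right' (ν := volume)).aemeasurable
  refine ⟨v, hv.trans ?_⟩
  rw [setLAverage_eq]
  refine ENNReal.div_le_of_le_mul ?_
  calc ∫⁻ v in cube n 0 s, ∫⁻ x, h x (cellCorner s (cellIndex s x) + v)
      = ∫⁻ x, ∫⁻ v in cube n 0 s, h x (cellCorner s (cellIndex s x) + v) :=
        lintegral_lintegral_swap hsample.aemeasurable
    _ ≤ ∫⁻ x, ∫⁻ t in cube n (-s) s, h x (x + t) :=
        lintegral_mono fun x => setLIntegral_cellCorner_add_le hs x (h x)
    _ = ∫⁻ t in cube n (-s) s, ∫⁻ x, h x (x + t) :=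
        (lintegral_lintegral_swap htranslate.aemeasurable).symm
    _ ≤ ∫⁻ _t in cube n (-s) s, K :=
        setLIntegral_mono' (measurableSet_cube _ _) fun t ht =>
          hK t fun i => abs_le.mpr ⟨(ht i).1, (ht i).2.le⟩
    _ = 2 ^ n * K * volume (cube n 0 s) := by
        rw [setLIntegral_const, hvol]
        ring

end Cells

section Sampling

variable {n : ℕ} {s D M : ℝ} {F : Type*} [NormedAddCommGroup F]

theorem enorm_sq_eq_lintegral_enorm_sq {X : Type*} [MeasurableSpace X] {μ : Measure X}
    (f : Lp F 2 μ) : ‖f‖ₑ ^ 2 = ∫⁻ x, ‖f x‖ₑ ^ 2 ∂μ := by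
  rw [Lp.enorm_def, eLpNorm_eq_lintegral_rpow_enorm_toReal (by norm_num) (by norm_num),
    ← ENNReal.rpow_natCast, ← ENNReal.rpow_mul]
  simp

variable [InnerProductSpace ℂ F]

theorem exists_lintegral_sub_cellCorner_add_le (hs : 0 < s) (hD : 0 ≤ D)
    {u : Lp F 2 (volume : Measure (EuclideanSpace ℝ (Fin n)))}
    (hu : ∀ y, ‖translateLp y u - u‖ ≤ ‖y‖ * D) :
    ∃ v, ∫⁻ x, ‖u x - u (cellCorner s (cellIndex s x) + v)‖ₑ ^ 2 ≤
      ENNReal.ofReal (2 ^ n * (n * s * D)) ^ 2 := by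
  have hu_meas := Lp.stronglyMeasurable u
  have htranslate (t : EuclideanSpace ℝ (Fin n)) (ht : ∀ i, |t i| ≤ s) :
      ∫⁻ x, ‖u x - u (x + t)‖ₑ ^ 2 ≤ ENNReal.ofReal (n * s * D) ^ 2 :=
    calc ∫⁻ x, ‖u x - u (x + t)‖ₑ ^ 2
        = ‖translateLp t u - u‖ₑ ^ 2 := by
          rw [enorm_sq_eq_lintegral_enorm_sq]
          refine lintegral_congr_ae ?_
          filter_upwards [Lp.coeFn_sub (translateLp t u) u, coeFn_translateLp t u] with x hsub htx
          rw [hsub, Pi.sub_apply, htx, enorm_sub_rev]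
      _ ≤ ENNReal.ofReal (n * s * D) ^ 2 := by
          rw [← ofReal_norm]
          gcongr
          exact (hu t).trans (by gcongr; exact norm_le_mul_of_forall_abs_le ht)
  obtain ⟨v, hv⟩ := exists_lintegral_cellCorner_add_le (h := fun x y => ‖u x - u y‖ₑ ^ 2) hs
    (((hu_meas.comp_measurable measurable_fst).sub
      (hu_meas.comp_measurable measurable_snd)).enorm.pow_const 2) htranslate
  refine ⟨v, hv.trans ?_⟩
  rw [ENNReal.ofReal_mul (p := 2 ^ n) (by positivity), ENNReal.ofReal_pow zero_le_two,
    ENNReal.ofReal_ofNat, mul_pow]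
  exact mul_le_mul_left (le_self_pow₀ (one_le_pow₀ one_le_two) two_ne_zero) _

variable [FiniteDimensional ℂ F]
  {R : Lp F 2 (volume : Measure (EuclideanSpace ℝ (Fin n))) →L[ℂ]
    Lp F 2 (volume : Measure (EuclideanSpace ℝ (Fin n)))}
  {φ : EuclideanSpace ℝ (Fin n) → ℂ}

theorem hasRankApprox_smulCLM_mul_of_cellIndex (hs : 0 < s) (hD : 0 ≤ D)
    (hR : ∀ y f, ‖translateLp y (R f) - R f‖ ≤ ‖y‖ * (D * ‖f‖)) (hφ : MemLp φ ∞ volume)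
    (hφ₂ : MemLp φ 2 volume) (hM : 0 ≤ M) (hφM : ∀ x, ‖φ x‖ ≤ M) {P : Finset (Fin n → ℤ)}
    (hφP : ∀ x, cellIndex s x ∉ P → φ x = 0) :
    HasRankApprox (smulCLM hφ * R) (P.card * Module.finrank ℂ F)
      (M * (2 ^ n * (n * s * D))) := by
  obtain ⟨U, hU, hrank, hstep⟩ :=
    exists_submodule_finrank_le_ae_eq_smul_comp (F := F) (measurable_cellIndex s) hφ₂ hφP
  refine .of_forall_exists_mem U (by exact_mod_cast hrank) (by positivity) fun f => ?_
  obtain ⟨v, hv⟩ := exists_lintegral_sub_cellCorner_add_le (D := D * ‖f‖) hs (by positivity)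
    fun y => hR y f
  obtain ⟨g, hgU, hg⟩ := hstep fun q => R f (cellCorner s q + v)
  refine ⟨g, hgU, ?_⟩
  rw [mul_apply_eq_comp]
  have henorm_sq : ‖smulCLM hφ (R f) - g‖ₑ ^ 2 ≤
      ENNReal.ofReal (M * (2 ^ n * (n * s * D)) * ‖f‖) ^ 2 :=
    calc ‖smulCLM hφ (R f) - g‖ₑ ^ 2
        = ∫⁻ x, ‖φ x‖ₑ ^ 2 * ‖R f x - R f (cellCorner s (cellIndex s x) + v)‖ₑ ^ 2 := by
          rw [enorm_sq_eq_lintegral_enorm_sq]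
          refine lintegral_congr_ae ?_
          filter_upwards [hg, Lp.coeFn_sub (smulCLM hφ (R f)) g, coeFn_smulCLM hφ (R f)]
            with x hgx hsub hφx
          rw [hsub, Pi.sub_apply, hφx, hgx, ← smul_sub, enorm_smul, mul_pow]
      _ ≤ ∫⁻ x, ENNReal.ofReal M ^ 2 *
            ‖R f x - R f (cellCorner s (cellIndex s x) + v)‖ₑ ^ 2 := by
          refine lintegral_mono fun x => ?_
          rw [← ofReal_norm (φ x)]
          gcongr
          exact hφM x
      _ ≤ ENNReal.ofReal M ^ 2 * ENNReal.ofReal (2 ^ n * (n * s * (D * ‖f‖))) ^ 2 := by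
          rw [lintegral_const_mul' _ _ (ENNReal.pow_ne_top ENNReal.ofReal_ne_top)]
          gcongr
      _ = ENNReal.ofReal (M * (2 ^ n * (n * s * D)) * ‖f‖) ^ 2 := by
          rw [← mul_pow, ← ENNReal.ofReal_mul hM]
          ring_nf
  have henorm := (ENNReal.pow_le_pow_left_iff two_ne_zero).mp henorm_sq
  rwa [← ofReal_norm, ENNReal.ofReal_le_ofReal_iff (by positivity)] at henorm

theorem hasRankApprox_smulCLM_mul_of_norm_lt (hD : 0 ≤ D)
    (hR : ∀ y f, ‖translateLp y (R f) - R f‖ ≤ ‖y‖ * (D * ‖f‖)) (hφ : MemLp φ ∞ volume)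
    (hM : 0 ≤ M) (hφM : ∀ x, ‖φ x‖ ≤ M) {L t : ℝ} (hL : 0 < L)
    (hφL : ∀ x, L ≤ ‖x‖ → φ x = 0) (ht : 1 ≤ t) :
    HasRankApprox (smulCLM hφ * R) ((4 * t) ^ n * Module.finrank ℂ F)
      (M * (2 ^ n * (n * (L / t) * D))) := by
  have ht₀ : 0 < t := by positivity
  have hφ₂ : MemLp φ 2 volume := hφ.mono_exponent_of_measure_support_ne_top
    (s := Metric.ball 0 L) (fun x hx => hφL x (by simpa using hx)) measure_ball_lt_top.ne le_top
  have hcells (x) (hx : cellIndex (L / t) x ∉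
      Fintype.piFinset fun _ => Finset.Ico (-⌈t⌉) ⌈t⌉) : φ x = 0 := by
    by_contra h
    refine hx (cellIndex_mem_piFinset (by positivity) ?_)
    calc ‖x‖ < L := lt_of_not_ge fun hLx => h (hφL x hLx)
      _ = t * (L / t) := by field_simp
      _ ≤ ⌈t⌉ * (L / t) := by gcongr; exact Int.le_ceil t
  refine (hasRankApprox_smulCLM_mul_of_cellIndex (by positivity) hD hR hφ hφ₂ hM hφM
    hcells).mono ?_ le_rfl
  have hcard : ((⌈t⌉ - -⌈t⌉).toNat : ℝ) ≤ 4 * t := by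
    have hceil : 0 ≤ ⌈t⌉ := Int.ceil_nonneg ht₀.le
    have htoNat : ((⌈t⌉ - -⌈t⌉).toNat : ℤ) = 2 * ⌈t⌉ := by omega
    have hcast : ((⌈t⌉ - -⌈t⌉).toNat : ℝ) = 2 * ⌈t⌉ := by exact_mod_cast htoNat
    linarith [Int.ceil_lt_add_one t]
  rw [Fintype.card_piFinset_const, Int.card_Ico, Nat.cast_pow]
  gcongr

end Sampling

end CellSampling

section DyadicShells

theorem HasApproxOrder.of_dyadic {𝕜 E : Type*} [NontriviallyNormedField 𝕜] [NormedAddCommGroup E]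
    [NormedSpace 𝕜 E] {T : E →L[𝕜] E} {C κ a γ : ℝ} (hκ : 0 < κ) (ha : 0 ≤ a) (hγ : γ ≤ a / κ)
    (h : ∀ I : ℕ, HasRankApprox T (C * (2 ^ I) ^ κ) (C * (2 ^ I) ^ (-a))) :
    HasApproxOrder T γ := by
  have hC : 0 ≤ C := by
    obtain ⟨S, m, -, -, hTS⟩ := h 0
    simpa using (norm_nonneg _).trans hTS
  refine ⟨C * 2 ^ a, fun t ht => ?_⟩
  have ht₀ : 0 < t := by positivity
  obtain ⟨I, hIt, htI⟩ := exists_nat_pow_near ht (Real.one_lt_rpow one_lt_two hκ)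
  rw [← Real.rpow_mul_natCast zero_le_two, mul_comm, Real.rpow_natCast_mul zero_le_two] at hIt htI
  have htγ : t ^ γ ≤ 2 ^ a * (2 ^ I) ^ a :=
    calc t ^ γ ≤ t ^ (a / κ) := Real.rpow_le_rpow_of_exponent_le ht hγ
      _ ≤ ((2 ^ (I + 1)) ^ κ) ^ (a / κ) := by gcongr
      _ = 2 ^ a * (2 ^ I) ^ a := by
        rw [← Real.rpow_mul (by positivity), mul_div_cancel₀ a hκ.ne', pow_succ',
          Real.mul_rpow zero_le_two (by positivity)]
  refine (h I).mono ?_ ?_ <;> rw [mul_assoc]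
  · gcongr
    exact hIt.trans (le_mul_of_one_le_left ht₀.le (Real.one_le_rpow one_le_two ha))
  · gcongr
    rw [Real.rpow_neg (by positivity), Real.rpow_neg ht₀.le, ← div_eq_mul_inv,
      inv_le_iff_one_le_mul₀ (by positivity), div_mul_eq_mul_div, one_le_div (by positivity)]
    exact htγ

section GeometricSums

variable {a b c d : ℝ}

theorem pow_rpow_eq_rpow_pow (i : ℕ) (s : ℝ) : ((2 : ℝ) ^ i) ^ s = (2 ^ s) ^ i := by
  rw [← Real.rpow_mul_natCast zero_le_two, mul_comm, Real.rpow_natCast_mul zero_le_two]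

theorem sum_shell_rank_le {n : ℕ} (hn : 1 ≤ n) (hb : b < 1) (hd : 0 ≤ d) (I : ℕ) :
    ∑ i ∈ Finset.range I, (4 * ((2 ^ i) ^ (1 - b) * (2 ^ I) ^ a)) ^ n * d ≤
      4 ^ n * d / (2 ^ (n * (1 - b)) - 1) * (2 ^ I) ^ (n * (a + 1 - b)) := by
  set q : ℝ := 2 ^ (n * (1 - b))
  have hq₁ : 0 < q - 1 := sub_pos.mpr (Real.one_lt_rpow one_lt_two
    (mul_pos (by exact_mod_cast hn) (by linarith)))
  have hpow (J : ℕ) : ((2 ^ J : ℝ) ^ (1 - b)) ^ n = q ^ J := by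
    rw [← Real.rpow_mul_natCast (by positivity), mul_comm, pow_rpow_eq_rpow_pow]
  calc ∑ i ∈ Finset.range I, (4 * ((2 ^ i) ^ (1 - b) * (2 ^ I) ^ a)) ^ n * d
      = 4 ^ n * d * ((2 ^ I) ^ a) ^ n * ∑ i ∈ Finset.range I, q ^ i := by
        rw [Finset.mul_sum]
        refine Finset.sum_congr rfl fun i _ => ?_
        rw [mul_pow, mul_pow, hpow]
        ring
    _ ≤ 4 ^ n * d * ((2 ^ I) ^ a) ^ n * (q ^ I / (q - 1)) := by
        rw [geom_sum_eq (by linarith)]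
        gcongr
        linarith
    _ = 4 ^ n * d / (q - 1) * (2 ^ I) ^ (n * (a + 1 - b)) := by
        have hexp : n * (a + 1 - b) = a * n + (1 - b) * n := by ring
        rw [← hpow, hexp, Real.rpow_add (by positivity), Real.rpow_mul_natCast (by positivity),
          Real.rpow_mul_natCast (by positivity)]
        ring

theorem sum_shell_error_le (hba : b < a) (hc : 0 ≤ c) (I : ℕ) :
    ∑ i ∈ Finset.range I, c * ((2 ^ i) ^ (-a) * (2 ^ i / ((2 ^ i) ^ (1 - b) * (2 ^ I) ^ a))) ≤
      c / (1 - 2 ^ (b - a)) * (2 ^ I) ^ (-a) := by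
  set p : ℝ := 2 ^ (b - a)
  have hp₁ : p < 1 := Real.rpow_lt_one_of_one_lt_of_neg one_lt_two (by linarith)
  have hpow (i : ℕ) : (2 ^ i : ℝ) ^ (-a) * (2 ^ i / (2 ^ i) ^ (1 - b)) = p ^ i := by
    have hexp : b - a = -a + (1 - (1 - b)) := by ring
    rw [← pow_rpow_eq_rpow_pow, hexp, Real.rpow_add (by positivity),
      Real.rpow_sub (by positivity) 1 (1 - b), Real.rpow_one]
  calc ∑ i ∈ Finset.range I, c * ((2 ^ i) ^ (-a) * (2 ^ i / ((2 ^ i) ^ (1 - b) * (2 ^ I) ^ a)))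
      = c * (2 ^ I) ^ (-a) * ∑ i ∈ Finset.range I, p ^ i := by
        rw [Finset.mul_sum, Real.rpow_neg (by positivity)]
        refine Finset.sum_congr rfl fun i _ => ?_
        rw [← hpow]
        field_simp
    _ ≤ c * (2 ^ I) ^ (-a) * (1 - p)⁻¹ := by
        gcongr
        rw [← tsum_geometric_of_lt_one (by positivity) hp₁]
        exact (summable_geometric_of_lt_one (by positivity) hp₁).sum_le_tsum _
          fun _ _ => by positivity
    _ = c / (1 - p) * (2 ^ I) ^ (-a) := by ring

end GeometricSums

variable {E : Type*} [NormedAddCommGroup E] {a K : ℝ}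

/-- The ball of radius `2 ^ i - 1`, so that the shells `dyadicBall (i + 1) \ dyadicBall i` with
`i : ℕ` exhaust the space and `1 + ‖x‖` is comparable to `2 ^ i` on each of them. -/
def dyadicBall (E : Type*) [NormedAddCommGroup E] (i : ℕ) : Set E := Metric.ball 0 (2 ^ i - 1)

theorem dyadicBall_zero : dyadicBall E 0 = ∅ := by simp [dyadicBall]

theorem dyadicBall_subset_succ (i : ℕ) : dyadicBall E i ⊆ dyadicBall E (i + 1) :=
  Metric.ball_subset_ball (by gcongr <;> simp)

theorem norm_le_of_notMem_dyadicBall {φ : E → ℂ} (ha : 0 ≤ a) (hK : 0 ≤ K)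
    (hφ : ∀ x, ‖φ x‖ ≤ K * (1 + ‖x‖) ^ (-a)) {i : ℕ} {x : E} (hx : x ∉ dyadicBall E i) :
    ‖φ x‖ ≤ K * (2 ^ i) ^ (-a) := by
  have hx' : 2 ^ i ≤ 1 + ‖x‖ := by
    rw [dyadicBall, mem_ball_zero_iff, not_lt] at hx
    linarith
  refine (hφ x).trans ?_
  gcongr ?_ * ?_
  exact Real.rpow_le_rpow_of_nonpos (by positivity) hx' (neg_nonpos.mpr ha)

variable [MeasurableSpace E] [OpensMeasurableSpace E]

theorem memLp_indicator_dyadicBall {φ : E → ℂ} {p : ℝ≥0∞} {μ : Measure E} (hφ : MemLp φ p μ)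
    (i : ℕ) : MemLp ((dyadicBall E i).indicator φ) p μ :=
  hφ.indicator measurableSet_ball

theorem sum_smulCLM_indicator_dyadicBall_sub {F : Type*} [NormedAddCommGroup F] [NormedSpace ℂ F]
    {p : ℝ≥0∞} [Fact (1 ≤ p)] {μ : Measure E} {φ : E → ℂ} (hφ : MemLp φ ∞ μ) (I : ℕ) :
    ∑ i ∈ Finset.range I, (smulCLM (memLp_indicator_dyadicBall hφ (i + 1)) -
      smulCLM (memLp_indicator_dyadicBall hφ i) : Lp F p μ →L[ℂ] Lp F p μ) =
      smulCLM (memLp_indicator_dyadicBall hφ I) := by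
  have hzero : (smulCLM (memLp_indicator_dyadicBall hφ 0) :
      Lp F p μ →L[ℂ] Lp F p μ) = 0 :=
    norm_le_zero_iff.mp (norm_smulCLM_le _ le_rfl (by simp [dyadicBall_zero]))
  rw [Finset.sum_range_sub (fun i => smulCLM (memLp_indicator_dyadicBall hφ i)), hzero,
    sub_zero]

end DyadicShells

section DecayingMultipliers

variable {n : ℕ} {a b D K : ℝ} {F : Type*} [NormedAddCommGroup F] [InnerProductSpace ℂ F]
  [FiniteDimensional ℂ F]
  {R : Lp F 2 (volume : Measure (EuclideanSpace ℝ (Fin n))) →L[ℂ]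
    Lp F 2 (volume : Measure (EuclideanSpace ℝ (Fin n)))}
  {φ : EuclideanSpace ℝ (Fin n) → ℂ}

theorem hasRankApprox_shell_mul (hD : 0 ≤ D)
    (hR : ∀ y f, ‖translateLp y (R f) - R f‖ ≤ ‖y‖ * (D * ‖f‖)) (hφ : MemLp φ ∞ volume)
    (ha : 0 ≤ a) (hK : 0 ≤ K) (hφa : ∀ x, ‖φ x‖ ≤ K * (1 + ‖x‖) ^ (-a)) (i : ℕ) {t : ℝ}
    (ht : 1 ≤ t) :
    HasRankApprox ((smulCLM (memLp_indicator_dyadicBall hφ (i + 1)) -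
        smulCLM (memLp_indicator_dyadicBall hφ i)) * R)
      ((4 * t) ^ n * Module.finrank ℂ F)
      (K * (2 ^ i) ^ (-a) * (2 ^ n * (n * (2 ^ (i + 1) / t) * D))) := by
  rw [smulCLM_sub_smulCLM _ _ ((memLp_indicator_dyadicBall hφ (i + 1)).sub
    (memLp_indicator_dyadicBall hφ i))]
  have hshell (x) : (dyadicBall _ (i + 1)).indicator φ x - (dyadicBall _ i).indicator φ x =
      (dyadicBall _ (i + 1) \ dyadicBall _ i).indicator φ x :=
    (congrFun (Set.indicator_sdiff (dyadicBall_subset_succ i) φ) x).symm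
  refine hasRankApprox_smulCLM_mul_of_norm_lt hD hR _ (by positivity) (fun x => ?_)
    (by positivity) (fun x hx => ?_) ht <;> rw [hshell]
  · by_cases hx : x ∈ dyadicBall _ (i + 1) \ dyadicBall _ i
    · rw [Set.indicator_of_mem hx]
      exact norm_le_of_notMem_dyadicBall ha hK hφa hx.2
    · rw [Set.indicator_of_notMem hx, norm_zero]
      positivity
  · refine Set.indicator_of_notMem (fun h => ?_) φ
    have hx' := mem_ball_zero_iff.mp h.1
    linarith

theorem norm_smulCLM_sub_indicator_dyadicBall_mul_le (hφ : MemLp φ ∞ volume) (ha : 0 ≤ a)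
    (hK : 0 ≤ K) (hφa : ∀ x, ‖φ x‖ ≤ K * (1 + ‖x‖) ^ (-a)) (I : ℕ) :
    ‖(smulCLM hφ - smulCLM (memLp_indicator_dyadicBall hφ I)) * R‖ ≤
      K * (2 ^ I) ^ (-a) * ‖R‖ := by
  rw [smulCLM_sub_smulCLM _ _ (hφ.sub (memLp_indicator_dyadicBall hφ I))]
  refine (norm_mul_le _ _).trans ?_
  gcongr
  refine norm_smulCLM_le _ (by positivity) (Filter.Eventually.of_forall fun x => ?_)
  by_cases hx : x ∈ dyadicBall _ I
  · rw [Set.indicator_of_mem hx, sub_self, norm_zero]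
    positivity
  · rw [Set.indicator_of_notMem hx, sub_zero]
    exact norm_le_of_notMem_dyadicBall ha hK hφa hx

/-- On the `i`-th shell the sampling uses `t = 2 ^ (i * (1 - b)) * 2 ^ (I * a)` cells per
direction. As `b < a ≤ 1`, the errors decrease and the ranks increase geometrically in `i`. -/
theorem exists_hasRankApprox_smulCLM_mul_dyadic (hn : 1 ≤ n) (hD : 0 ≤ D)
    (hR : ∀ y f, ‖translateLp y (R f) - R f‖ ≤ ‖y‖ * (D * ‖f‖)) (hφ : MemLp φ ∞ volume)
    (ha : 0 ≤ a) (ha₁ : a ≤ 1) (hba : b < a) (hK : 0 ≤ K)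
    (hφa : ∀ x, ‖φ x‖ ≤ K * (1 + ‖x‖) ^ (-a)) :
    ∃ C, ∀ I : ℕ, HasRankApprox (smulCLM hφ * R) (C * (2 ^ I) ^ (n * (a + 1 - b)))
      (C * (2 ^ I) ^ (-a)) := by
  set c := K * (2 ^ n * (n * 2 * D)) with hc
  refine ⟨max (4 ^ n * Module.finrank ℂ F / (2 ^ (n * (1 - b)) - 1))
    (c / (1 - 2 ^ (b - a)) + K * ‖R‖), fun I => ?_⟩
  have ht (i : ℕ) : 1 ≤ (2 ^ i : ℝ) ^ (1 - b) * (2 ^ I) ^ a :=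
    one_le_mul_of_one_le_of_one_le
      (Real.one_le_rpow (one_le_pow₀ one_le_two) (by linarith))
      (Real.one_le_rpow (one_le_pow₀ one_le_two) ha)
  have hshells := HasRankApprox.sum (Finset.range I) fun i _ =>
    hasRankApprox_shell_mul hD hR hφ ha hK hφa i (ht i)
  rw [← Finset.sum_mul, sum_smulCLM_indicator_dyadicBall_sub hφ] at hshells
  have hsum := hshells.add (HasRankApprox.of_norm_le
    (norm_smulCLM_sub_indicator_dyadicBall_mul_le (R := R) hφ ha hK hφa I))
  rw [← add_mul, add_sub_cancel, add_zero] at hsum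
  refine hsum.mono ?_ ?_
  · refine (sum_shell_rank_le hn (by linarith) (Nat.cast_nonneg _) I).trans ?_
    gcongr
    exact le_max_left _ _
  · have herror := sum_shell_error_le hba (c := c) (by positivity) I
    calc _ ≤ c / (1 - 2 ^ (b - a)) * (2 ^ I) ^ (-a) + K * (2 ^ I) ^ (-a) * ‖R‖ := by
          refine add_le_add_left (le_of_eq_of_le (Finset.sum_congr rfl fun i _ => ?_) herror) _
          rw [hc]
          ring
      _ = (c / (1 - 2 ^ (b - a)) + K * ‖R‖) * (2 ^ I) ^ (-a) := by ring
      _ ≤ _ := by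
          gcongr
          exact le_max_right _ _

/-- The factor `(1 + ‖x‖) ^ (-a)` improves the order `1 / n` of `R` on bounded sets into an order
below `a / n` on the whole space. -/
theorem hasApproxOrder_smulCLM_mul (hn : 1 ≤ n) (hD : 0 ≤ D)
    (hR : ∀ y f, ‖translateLp y (R f) - R f‖ ≤ ‖y‖ * (D * ‖f‖)) (hφ : MemLp φ ∞ volume)
    (ha : 0 ≤ a) (ha₁ : a ≤ 1) (hK : 0 ≤ K) (hφa : ∀ x, ‖φ x‖ ≤ K * (1 + ‖x‖) ^ (-a)) {γ : ℝ}
    (hγ : γ * n < a) : HasApproxOrder (smulCLM hφ * R) γ := by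
  have hn' : (0 : ℝ) < n := by exact_mod_cast hn
  set η := (a - γ * n) / (|γ * n| + 1) with hη
  have hη₀ : 0 < η := div_pos (by linarith) (by positivity)
  have hγη : γ * n * η ≤ a - γ * n := by
    rw [hη, mul_div_assoc', div_le_iff₀ (by positivity), mul_comm]
    exact mul_le_mul_of_nonneg_left (by linarith [le_abs_self (γ * n)]) (by linarith)
  obtain ⟨C, hC⟩ := exists_hasRankApprox_smulCLM_mul_dyadic (b := a - η) hn hD hR hφ ha ha₁
    (by linarith) hK hφa
  have hκ : 0 < n * (a + 1 - (a - η)) := mul_pos hn' (by linarith)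
  refine .of_dyadic hκ ha ?_ hC
  rw [le_div_iff₀ hκ]
  linarith

end DecayingMultipliers

section WeightedResolvents

variable {n N : ℕ} {α : Fin (n + 1) → Matrix (Fin N) (Fin N) ℂ} {ε s t a γ : ℝ} {z : ℂ}
  {D R R' : SpinorL2 n N →L[ℂ] SpinorL2 n N}

theorem japaneseWeight_le_mul_rpow {E : Type*} [NormedAddCommGroup E] [NormedSpace ℝ E]
    (hε : 0 < ε) (hs : 0 ≤ s) (x : E) :
    japaneseWeight ε s x ≤ 2 ^ (s / 2) * (min 1 ε) ^ (-s) * (1 + ‖x‖) ^ (-s) := by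
  rcases hs.eq_or_lt with rfl | hs
  · simp [japaneseWeight]
  have hmin : 0 < min 1 ε := lt_min one_pos hε
  have hnorm : min 1 ε * (1 + ‖x‖) ≤ 1 + ‖ε • x‖ := by
    rw [norm_smul, Real.norm_of_nonneg hε.le, mul_add, mul_one]
    gcongr
    · exact min_le_left _ _
    · exact min_le_right _ _
  calc japaneseWeight ε s x ≤ 2 ^ (s / 2) * (1 + ‖ε • x‖) ^ (-s) :=
        rpow_neg_one_add_norm_sq_le _ hs
    _ ≤ 2 ^ (s / 2) * (min 1 ε * (1 + ‖x‖)) ^ (-s) := by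
        gcongr ?_ * ?_
        exact Real.rpow_le_rpow_of_nonpos (by positivity) hnorm (neg_nonpos.mpr hs.le)
    _ = 2 ^ (s / 2) * (min 1 ε) ^ (-s) * (1 + ‖x‖) ^ (-s) := by
        rw [Real.mul_rpow hmin.le (by positivity), mul_assoc]

theorem IsResolvent.hasApproxOrder_weightCLM_mul (hn : 1 ≤ n) (hα : IsDiracFamily α) (hε : 0 < ε)
    (ha : 0 ≤ a) (ha₁ : a ≤ 1) (hγ : γ * n < a)
    (h : IsResolvent ((D : SpinorL2 n N →ₗ[ℂ] SpinorL2 n N) +ᵥ freeDirac α) z R) :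
    HasApproxOrder (weightCLM ε ha * R) γ := by
  refine hasApproxOrder_smulCLM_mul (K := 2 ^ (a / 2) * (min 1 ε) ^ (-a)) hn (by positivity)
    (h.norm_translateLp_sub_le hα) _ ha ha₁ (by positivity) (fun x => ?_) hγ
  rw [Complex.norm_real, Real.norm_of_nonneg (japaneseWeight_pos ε a x).le]
  exact japaneseWeight_le_mul_rpow hε ha x

theorem vadd_freeDirac_weightCLM (hε : 0 ≤ ε) (hs : 0 ≤ s) (hD : Commute (weightCLM ε hs) D)
    (f : (freeDirac α).domain) :
    ∃ h : weightCLM ε hs (f : SpinorL2 n N) ∈ (freeDirac α).domain,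
      ((D : SpinorL2 n N →ₗ[ℂ] SpinorL2 n N) +ᵥ freeDirac α) ⟨weightCLM ε hs f, h⟩ =
        weightCLM ε hs (((D : SpinorL2 n N →ₗ[ℂ] SpinorL2 n N) +ᵥ freeDirac α) f +
          weightPotentialCLM α hε hs f) := by
  obtain ⟨h, hH₀⟩ := freeDirac_weightCLM hε hs f
  refine ⟨h, ?_⟩
  have hDf : (D : SpinorL2 n N →ₗ[ℂ] SpinorL2 n N) (weightCLM ε hs f) =
      weightCLM ε hs ((D : SpinorL2 n N →ₗ[ℂ] SpinorL2 n N) f) :=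
    (DFunLike.congr_fun hD.eq _).symm
  rw [LinearPMap.vadd_apply, LinearPMap.vadd_apply, hH₀, hDf, ← map_add, add_assoc]

theorem IsResolvent.mul_weightCLM (hε : 0 ≤ ε) (hs : 0 ≤ s) (hD : Commute (weightCLM ε hs) D)
    (h : IsResolvent ((D : SpinorL2 n N →ₗ[ℂ] SpinorL2 n N) +ᵥ freeDirac α) z R)
    (h' : IsResolvent (((weightPotentialCLM α hε hs : SpinorL2 n N →L[ℂ] SpinorL2 n N) :
      SpinorL2 n N →ₗ[ℂ] SpinorL2 n N) +ᵥ
        ((D : SpinorL2 n N →ₗ[ℂ] SpinorL2 n N) +ᵥ freeDirac α)) z R') :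
    R * weightCLM ε hs = weightCLM ε hs * R' :=
  h.mul_eq_mul h' fun f hf => (vadd_freeDirac_weightCLM hε hs hD ⟨f, hf⟩).imp fun _ hW => by
    rw [hW, LinearPMap.vadd_apply _ _ ⟨f, hf⟩, add_comm]
    rfl

theorem IsResolvent.weightCLM_mul (hε : 0 ≤ ε) (hs : 0 ≤ s) (hD : Commute (weightCLM ε hs) D)
    (h : IsResolvent ((D : SpinorL2 n N →ₗ[ℂ] SpinorL2 n N) +ᵥ freeDirac α) z R)
    (h' : IsResolvent (((-weightPotentialCLM α hε hs : SpinorL2 n N →L[ℂ] SpinorL2 n N) :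
      SpinorL2 n N →ₗ[ℂ] SpinorL2 n N) +ᵥ
        ((D : SpinorL2 n N →ₗ[ℂ] SpinorL2 n N) +ᵥ freeDirac α)) z R') :
    weightCLM ε hs * R = R' * weightCLM ε hs := by
  have hB : Commute (weightCLM ε hs) (weightPotentialCLM α hε hs) := smulCLM_commute_mulCLM _ _
  refine (h'.mul_eq_mul h fun f hf =>
    (vadd_freeDirac_weightCLM (α := α) hε hs hD ⟨f, hf⟩).imp fun hWf hW => ?_).symm
  have hBf : weightPotentialCLM α hε hs (weightCLM ε hs f) =
      weightCLM ε hs (weightPotentialCLM α hε hs f) := (DFunLike.congr_fun hB.eq _).symm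
  rw [LinearPMap.vadd_apply _ _ ⟨weightCLM ε hs f, hWf⟩, hW, map_add, ← hBf]
  exact neg_add_cancel_comm_assoc _ _

theorem IsResolvent.exists_weightPotentialCLM_vadd {T : SpinorL2 n N →ₗ.[ℂ] SpinorL2 n N}
    (hα : IsDiracFamily α) (hε : 0 ≤ ε) (hs : 0 ≤ s) (hsR : s * ε * ‖R‖ < 1)
    (h : IsResolvent T z R) :
    (∃ R', IsResolvent (((weightPotentialCLM α hε hs : SpinorL2 n N →L[ℂ] SpinorL2 n N) :
      SpinorL2 n N →ₗ[ℂ] SpinorL2 n N) +ᵥ T) z R') ∧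
    ∃ R', IsResolvent (((-weightPotentialCLM α hε hs : SpinorL2 n N →L[ℂ] SpinorL2 n N) :
      SpinorL2 n N →ₗ[ℂ] SpinorL2 n N) +ᵥ T) z R' := by
  have hlt : ‖weightPotentialCLM α hε hs‖ * ‖R‖ < 1 :=
    (mul_le_mul_of_nonneg_right (norm_weightPotentialCLM_le hα hε hs) (norm_nonneg R)).trans_lt hsR
  exact ⟨h.exists_vadd_of_norm_mul_lt_one hlt,
    h.exists_vadd_of_norm_mul_lt_one (by rwa [norm_neg])⟩

theorem weightCLM_natCast_succ_mul (m : ℕ) (ha : 0 ≤ a) :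
    (weightCLM ε (mul_nonneg (m + 1).cast_nonneg ha) : SpinorL2 n N →L[ℂ] SpinorL2 n N) =
      weightCLM ε (mul_nonneg m.cast_nonneg ha) * weightCLM ε ha := by
  rw [← weightCLM_add]
  simp only [Nat.cast_succ, add_one_mul]

theorem IsResolvent.hasApproxOrder_pow_mul_weightCLM (hn : 1 ≤ n) (hα : IsDiracFamily α)
    (hε : 0 < ε) (ha : 0 ≤ a) (ha₁ : a ≤ 1) (hγ : γ * n < a)
    (hD : ∀ {s} (hs : 0 ≤ s), Commute (weightCLM ε hs) D)
    (h : IsResolvent ((D : SpinorL2 n N →ₗ[ℂ] SpinorL2 n N) +ᵥ freeDirac α) z R) (m : ℕ)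
    (hm : m * a * ε * ‖R‖ < 1) :
    HasApproxOrder (R ^ m * weightCLM ε (mul_nonneg m.cast_nonneg ha)) (m * γ) := by
  induction m with
  | zero => simpa using HasApproxOrder.zero_order _
  | succ m ih =>
    obtain ⟨R', hR'⟩ := (h.exists_weightPotentialCLM_vadd hα hε.le _ hm).1
    have hfactor : R ^ (m + 1) * weightCLM ε (mul_nonneg (m + 1).cast_nonneg ha) =
        R ^ m * weightCLM ε (mul_nonneg m.cast_nonneg ha) * (weightCLM ε ha * R') := by
      rw [pow_succ, mul_assoc, h.mul_weightCLM hε.le _ (hD _) hR',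
        weightCLM_natCast_succ_mul m ha]
      simp only [mul_assoc]
    rw [vadd_vadd, ← ContinuousLinearMap.toLinearMap_add] at hR'
    rw [hfactor, Nat.cast_succ, add_one_mul]
    refine (ih (lt_of_le_of_lt ?_ hm)).mul (hR'.hasApproxOrder_weightCLM_mul hn hα hε ha ha₁ hγ)
    gcongr
    exact m.le_succ

theorem IsResolvent.hasApproxOrder_weightCLM_mul_pow (hn : 1 ≤ n) (hα : IsDiracFamily α)
    (hε : 0 < ε) (ha : 0 ≤ a) (ha₁ : a ≤ 1) (hγ : γ * n < a)
    (hD : ∀ {s} (hs : 0 ≤ s), Commute (weightCLM ε hs) D)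
    (h : IsResolvent ((D : SpinorL2 n N →ₗ[ℂ] SpinorL2 n N) +ᵥ freeDirac α) z R) (m : ℕ)
    (hm : m * a * ε * ‖R‖ < 1) :
    HasApproxOrder (weightCLM ε (mul_nonneg m.cast_nonneg ha) * R ^ m) (m * γ) := by
  induction m with
  | zero => simpa using HasApproxOrder.zero_order _
  | succ m ih =>
    have hm' : m * a * ε * ‖R‖ < 1 := by
      refine lt_of_le_of_lt ?_ hm
      gcongr
      exact m.le_succ
    obtain ⟨R', hR'⟩ := (h.exists_weightPotentialCLM_vadd hα hε.le
      (mul_nonneg m.cast_nonneg ha) hm').2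
    have hcomm : Commute (weightCLM ε (mul_nonneg m.cast_nonneg ha) :
        SpinorL2 n N →L[ℂ] SpinorL2 n N) (weightCLM ε ha) := by
      rw [Commute, SemiconjBy, ← weightCLM_add, ← weightCLM_add]
      simp only [add_comm]
    have hfactor : weightCLM ε (mul_nonneg (m + 1).cast_nonneg ha) * R ^ (m + 1) =
        weightCLM ε ha * R' * (weightCLM ε (mul_nonneg m.cast_nonneg ha) * R ^ m) := by
      rw [pow_succ', weightCLM_natCast_succ_mul m ha, hcomm.eq, mul_assoc, ← mul_assoc _ R,
        h.weightCLM_mul hε.le _ (hD _) hR']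
      simp only [mul_assoc]
    rw [vadd_vadd, ← ContinuousLinearMap.toLinearMap_add] at hR'
    rw [hfactor, Nat.cast_succ, add_one_mul, add_comm]
    exact (hR'.hasApproxOrder_weightCLM_mul hn hα hε ha ha₁ hγ).mul (ih hm')

end WeightedResolvents

section DecayingPotentials

variable {n N : ℕ} {α : Fin (n + 1) → Matrix (Fin N) (Fin N) ℂ} {C ρ ε s t : ℝ}
  {V : EuclideanSpace ℝ (Fin n) → Matrix (Fin N) (Fin N) ℂ}

theorem japaneseWeight_neg_le_sqrt_rpow {E : Type*} [NormedAddCommGroup E] [NormedSpace ℝ E]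
    (hε : 0 ≤ ε) (hε₁ : ε ≤ 1) (hs : 0 ≤ s) (hsρ : s ≤ ρ) (x : E) :
    japaneseWeight ε (-s) x ≤ √(1 + ‖x‖ ^ 2) ^ ρ := by
  rw [japaneseWeight, neg_neg]
  calc (1 + ‖ε • x‖ ^ 2) ^ (s / 2) ≤ (1 + ‖x‖ ^ 2) ^ (s / 2) := by
        rw [norm_smul, Real.norm_of_nonneg hε]
        gcongr
        exact mul_le_of_le_one_left (norm_nonneg x) hε₁
    _ = √(1 + ‖x‖ ^ 2) ^ s := by
        rw [Real.sqrt_eq_rpow, ← Real.rpow_mul (by positivity), one_div_mul_eq_div]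
    _ ≤ √(1 + ‖x‖ ^ 2) ^ ρ :=
        Real.rpow_le_rpow_of_exponent_le (Real.one_le_sqrt.mpr (by simp)) hsρ

theorem memLp_japaneseWeight_smul (hε : 0 ≤ ε) (hε₁ : ε ≤ 1) (hs : 0 ≤ s) (hsρ : s ≤ ρ)
    (hV : ∀ l m, MemLp (fun x => V x l m) ∞ volume)
    (hdecay : ∀ l m, ∀ᵐ x, ‖V x l m‖ ≤ C * √(1 + ‖x‖ ^ 2) ^ (-ρ)) (l m : Fin N) :
    MemLp (fun x => ((japaneseWeight ε (-s) x : ℂ) • V x) l m) ∞ volume := by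
  have hcont := (hasTemperateGrowth_japaneseWeight (E := EuclideanSpace ℝ (Fin n)) ε (-s)).1
    |>.continuous
  refine memLp_top_of_bound (AEStronglyMeasurable.smul (Continuous.aestronglyMeasurable
    (Complex.continuous_ofReal.comp hcont)) (hV l m).1) C ?_
  filter_upwards [hdecay l m] with x hx
  have hsqrt : 0 < √(1 + ‖x‖ ^ 2) := by positivity
  rw [Matrix.smul_apply, norm_smul, Complex.norm_real,
    Real.norm_of_nonneg (japaneseWeight_pos ε (-s) x).le]
  calc japaneseWeight ε (-s) x * ‖V x l m‖
      ≤ √(1 + ‖x‖ ^ 2) ^ ρ * (C * √(1 + ‖x‖ ^ 2) ^ (-ρ)) := by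
        gcongr
        exact japaneseWeight_neg_le_sqrt_rpow hε hε₁ hs hsρ x
    _ = C := by
        rw [mul_left_comm, ← Real.rpow_add hsqrt, add_neg_cancel, Real.rpow_zero, mul_one]

theorem exists_mulCLM_eq_weightCLM_mul_mul_weightCLM (hε : 0 ≤ ε) (hε₁ : ε ≤ 1) (hs : 0 ≤ s)
    (ht : 0 ≤ t) (hst : s + t ≤ ρ) (hV : ∀ l m, MemLp (fun x => V x l m) ∞ volume)
    (hdecay : ∀ l m, ∀ᵐ x, ‖V x l m‖ ≤ C * √(1 + ‖x‖ ^ 2) ^ (-ρ)) :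
    ∃ A : SpinorL2 n N →L[ℂ] SpinorL2 n N, mulCLM V hV = weightCLM ε hs * A * weightCLM ε ht := by
  have hU := memLp_japaneseWeight_smul hε hε₁ (add_nonneg hs ht) hst hV hdecay
  refine ⟨mulCLM _ hU, ?_⟩
  have hcomm : Commute (weightCLM ε ht) (mulCLM _ hU) := smulCLM_commute_mulCLM _ hU
  rw [mul_assoc, ← hcomm.eq, ← mul_assoc, ← weightCLM_add]
  refine (smulCLM_mul_mulCLM _ hU hV (.of_forall fun x => ?_)).symm
  rw [smul_smul, ← Complex.ofReal_mul, ← japaneseWeight_add, add_neg_cancel, japaneseWeight_zero,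
    Complex.ofReal_one, one_smul]

theorem exists_weight_exponents {n k : ℕ} (hn : 1 ≤ n) (hk : n ≤ k) (hρ : n < ρ) :
    ∃ a γ : ℝ, 0 ≤ a ∧ a ≤ 1 ∧ γ * n < a ∧ 1 < (k + 1) * γ ∧ (k + 1) * a ≤ ρ := by
  have hn₀ : (0 : ℝ) < n := by exact_mod_cast hn
  have hk₀ : (0 : ℝ) < k + 1 := by positivity
  have hna : n / (k + 1) < min 1 (ρ / (k + 1)) := by
    refine lt_min ((div_lt_one hk₀).mpr ?_) (by gcongr)
    exact_mod_cast Nat.lt_succ_of_le hk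
  obtain ⟨γ, hkγ, hγa⟩ : ∃ γ, 1 / (k + 1 : ℝ) < γ ∧ γ < min 1 (ρ / (k + 1)) / n :=
    exists_between (by rwa [lt_div_iff₀ hn₀, one_div_mul_eq_div])
  exact ⟨_, γ, le_min zero_le_one (by positivity [hn₀.trans hρ]), min_le_left _ _,
    (lt_div_iff₀ hn₀).mp hγa, (div_lt_iff₀' hk₀).mp hkγ,
    (le_div_iff₀' hk₀).mp (min_le_right _ _)⟩

theorem exists_weight_scale {a M : ℝ} (ha : 0 ≤ a) (hM : 0 ≤ M) (k : ℕ) :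
    ∃ ε : ℝ, 0 < ε ∧ ε ≤ 1 ∧ ∀ m ≤ k, ∀ r ≤ M, m * a * ε * r < 1 := by
  obtain ⟨ε, hε, hεlt⟩ := exists_pos_mul_lt one_pos (max 1 (k * a * M))
  refine ⟨ε, hε, (le_mul_of_one_le_left hε.le (le_max_left _ _)).trans hεlt.le,
    fun m hm r hr => ?_⟩
  calc m * a * ε * r ≤ m * a * ε * M := by gcongr
    _ ≤ k * a * ε * M := by gcongr
    _ = k * a * M * ε := by ring
    _ ≤ max 1 (k * a * M) * ε := by
      gcongr
      exact le_max_right _ _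
    _ < 1 := hεlt

theorem isTraceClass_pow_sub_pow (hn : 1 ≤ n) (hα : IsDiracFamily α)
    (hV : ∀ l m, MemLp (fun x => V x l m) ∞ volume) (hρ : n < ρ)
    (hdecay : ∀ l m, ∀ᵐ x, ‖V x l m‖ ≤ C * √(1 + ‖x‖ ^ 2) ^ (-ρ)) {k : ℕ} (hk : n ≤ k) {z : ℂ}
    {R R₀ : SpinorL2 n N →L[ℂ] SpinorL2 n N} (hR : IsResolvent (dirac α V hV) z R)
    (hR₀ : IsResolvent (freeDirac α) z R₀) : IsTraceClass (R ^ k - R₀ ^ k) := by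
  obtain ⟨a, γ, ha, ha₁, hγa, hkγ, hkρ⟩ := exists_weight_exponents hn hk hρ
  obtain ⟨ε, hε, hε₁, hsmall⟩ := exists_weight_scale ha (le_max_of_le_left (norm_nonneg R)) k
  replace hR : IsResolvent ((mulCLM V hV : SpinorL2 n N →ₗ[ℂ] SpinorL2 n N) +ᵥ freeDirac α) z R :=
    hR
  have hR₀' : IsResolvent (((0 : SpinorL2 n N →L[ℂ] SpinorL2 n N) :
      SpinorL2 n N →ₗ[ℂ] SpinorL2 n N) +ᵥ freeDirac α) z R₀ := by
    rwa [ContinuousLinearMap.toLinearMap_zero, zero_vadd]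
  rw [hR.pow_sub_pow hR₀ k]
  refine (HasApproxOrder.sum _ fun j hj => ?_).isTraceClass hkγ
  have hjk : j + 1 ≤ k := Finset.mem_range.mp hj
  have hcast : (k + 1 : ℝ) = (j + 1 : ℕ) + (k - j : ℕ) := by
    exact_mod_cast (by omega : k + 1 = j + 1 + (k - j))
  rw [hcast, add_mul] at hkρ ⊢
  obtain ⟨A, hA⟩ := exists_mulCLM_eq_weightCLM_mul_mul_weightCLM hε.le hε₁
    (mul_nonneg (j + 1).cast_nonneg ha) (mul_nonneg (k - j).cast_nonneg ha) hkρ hV hdecay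
  have hleft := hR.hasApproxOrder_pow_mul_weightCLM hn hα hε ha ha₁ hγa
    (fun _ => smulCLM_commute_mulCLM _ hV) (j + 1) (hsmall _ hjk _ (le_max_left _ ‖R₀‖))
  have hright := hR₀'.hasApproxOrder_weightCLM_mul_pow hn hα hε ha ha₁ hγa
    (fun _ => Commute.zero_right _) (k - j) (hsmall _ (Nat.sub_le k j) _ (le_max_right _ _))
  have hfactor : R ^ (j + 1) * -mulCLM V hV * R₀ ^ (k - j) =
      R ^ (j + 1) * weightCLM ε (mul_nonneg (j + 1).cast_nonneg ha) * -A *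
        (weightCLM ε (mul_nonneg (k - j).cast_nonneg ha) * R₀ ^ (k - j)) := by
    rw [hA]
    noncomm_ring
  rw [hfactor]
  exact (hleft.mul_right (-A)).mul hright

end DecayingPotentials

theorem theoremt7p4_general {n N : ℕ} (hn : 1 ≤ n)
    {α : Fin (n + 1) → Matrix (Fin N) (Fin N) ℂ} (hα : IsDiracFamily α)
    {V : EuclideanSpace ℝ (Fin n) → Matrix (Fin N) (Fin N) ℂ}
    (hV : ∀ l m, MemLp (fun x => V x l m) ∞ volume) {C ρ : ℝ} (hρ : (n : ℝ) < ρ)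
    (hdecay : ∀ l m, ∀ᵐ x : EuclideanSpace ℝ (Fin n), ‖V x l m‖ ≤ C * √(1 + ‖x‖ ^ 2) ^ (-ρ))
    {k : ℕ} (hk : n ≤ k) {z : ℂ} (hz : z.im ≠ 0) :
    z ∈ pmapResolventSet (freeDirac α) ∧
    ((∀ᵐ x : EuclideanSpace ℝ (Fin n), (V x).IsHermitian) →
      z ∈ pmapResolventSet (dirac α V hV)) ∧
    (∀ R R₀ : SpinorL2 n N →L[ℂ] SpinorL2 n N,
      IsResolvent (dirac α V hV) z R → IsResolvent (freeDirac α) z R₀ →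
        IsTraceClass (R ^ k - R₀ ^ k)) :=
  ⟨⟨_, isResolvent_freeResolvent hα hz⟩,
    fun hVh => (isResolvent_freeResolvent hα hz).exists_vadd_of_isSymmetric (D := mulCLM V hV) hz
      hα.isFormalAdjoint_freeDirac (isSymmetric_mulOp hV hVh),
    fun _ _ hR hR₀ => isTraceClass_pow_sub_pow hn hα hV hρ hdecay hk hR hR₀⟩

theorem theoremt7p4 (n : ℕ) (hn : 1 ≤ n)
    (α : Fin (n + 1) → Matrix (Fin (spinorDim n)) (Fin (spinorDim n)) ℂ) (hα : IsDiracFamily α)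
    (V : EuclideanSpace ℝ (Fin n) → Matrix (Fin (spinorDim n)) (Fin (spinorDim n)) ℂ)
    (hV : ∀ l m, MemLp (fun x => V x l m) ∞ volume)
    (C ρ : ℝ) (hC : 0 < C) (hρ : (n : ℝ) < ρ)
    (hdecay : ∀ l m, ∀ᵐ x : EuclideanSpace ℝ (Fin n),
      ‖V x l m‖ ≤ C * (Real.sqrt (1 + ‖x‖ ^ 2)) ^ (-ρ))
    (k : ℕ) (hk : n ≤ k) (z : ℂ) (hz : z.im ≠ 0) :
    z ∈ pmapResolventSet (freeDirac α) ∧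
    ((∀ᵐ x : EuclideanSpace ℝ (Fin n), (V x).IsHermitian) →
      z ∈ pmapResolventSet (dirac α V hV)) ∧
    (∀ R R₀ : SpinorL2 n (spinorDim n) →L[ℂ] SpinorL2 n (spinorDim n),
      IsResolvent (dirac α V hV) z R → IsResolvent (freeDirac α) z R₀ →
        IsTraceClass (R ^ k - R₀ ^ k)) :=
  theoremt7p4_general hn hα hV hρ hdecay hk hz
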